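/- Let $(\mathcal C,\otimes,E)$ be a monoidal category with associativity and unit isomorphisms $\alpha,\lambda,\rho$, and let $\mathbb T=(T,\mu,\eta)$ be a monad on $\mathcal C$ that is monoidal: there is a family $\kappa_{X,Y}:TX\otimes TY\to T(X\otimes Y)$, natural in $X$ and $Y$, such that $(T,\kappa,\eta_E)$ is a lax monoidal functor, and such that $\mu_{X\otimes Y}\cdot T\kappa_{X,Y}\cdot\kappa_{TX,TY}=\kappa_{X,Y}\cdot(\mu_X\otimes\mu_Y)$ and $\kappa_{X,Y}\cdot(\eta_X\otimes\eta_Y)=\eta_{X\otimes Y}$ for all $X,Y$. Suppose that $\mathcal C$ has reflexive coequalizers and that, for all objects $X,Y$ of $\mathcal C$, the functors $T(X\otimes-)$ and $T(-\otimes Y):\mathcal C\to\mathcal C$ preserve reflexive coequalizers. Then, for all $\mathbb T$-algebras $(A,a)$ and $(B,b)$, the coequalizer $$q_{A,B}:T(A\otimes B)\to A\boxtimes B$$ of $\mu_{A\otimes B}\cdot T\kappa_{A,B}$ and $T(a\otimes b):T(TA\otimes TB)\to T(A\otimes B)$ exists in the category $\mathcal C^{\mathbb T}$ of Eilenberg–Moore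 algebras. For any choice of these coequalizers, let $g\boxtimes h$ denote the unique $\mathcal C^{\mathbb T}$-morphism with $(g\boxtimes h)\cdot q_{A,B}=q_{A',B'}\cdot T(g\otimes h)$, where $g:A\to A'$ and $h:B\to B'$ are $\mathcal C^{\mathbb T}$-morphisms. There are unique families of isomorphisms $\overline\alpha_{A,B,C}:(A\boxtimes B)\boxtimes C\to A\boxtimes(B\boxtimes C)$, $\overline\lambda_A:TE\boxtimes A\to A$ and $\overline\rho_A:A\boxtimes TE\to A$ in $\mathcal C^{\mathbb T}$ (for $\mathbb T$-algebras $(A,a),(B,b),(C,c)$) that are induced by $\alpha,\lambda,\rho$ in the sense that $$\overline\alpha_{A,B,C}\cdot q_{A\boxtimes B,C}\cdot T\big((q_{A,B}\cdot\eta_{A\otimes B})\otimes 1_C\big)=q_{A,B\boxtimes C}\cdot T\big(1_A\otimes(q_{B,C}\cdot\eta_{B\otimes C})\big)\cdot T\alpha_{A,B,C},$$ $$\overline\lambda_A\cdot q_{TE,A}=a\cdot T\big(a\cdot T\lambda_A\cdot\kappa_{E,A}\cdot(1_{TE}\otimes\eta_A)\big),\qquad \overline\rho_A\cdot q_{A,TE}=a\cdot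 T\big(a\cdot T\rho_A\cdot\kappa_{A,E}\cdot(\eta_A\otimes 1_{TE})\big),$$ and with them $(\mathcal C^{\mathbb T},\boxtimes,\overline\alpha,TE,\overline\lambda,\overline\rho)$ is a monoidal category (here $TE$ carries the free algebra structure $\mu_E$). Moreover, if $(\mathcal C,\otimes,E)$ is symmetric monoidal with symmetry $\sigma$, and $(\mathbb T,\kappa)$ is symmetric, that is, $\kappa_{Y,X}\cdot\sigma_{TX,TY}=T\sigma_{X,Y}\cdot\kappa_{X,Y}$ for all $X,Y$, then there is a unique family of isomorphisms $\overline\sigma_{A,B}:A\boxtimes B\to B\boxtimes A$ in $\mathcal C^{\mathbb T}$ with $\overline\sigma_{A,B}\cdot q_{A,B}=q_{B,A}\cdot T\sigma_{A,B}$, and it makes this monoidal category symmetric monoidal. -/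

import Mathlib

open CategoryTheory MonoidalCategory Limits

universe v u

namespace MonoidalMonad

/-- A monad `T` whose underlying functor carries a lax monoidal structure
`(ε, κ)`, `κ X Y : T X ⊗ T Y ⟶ T (X ⊗ Y)`, is a *monoidal monad* if the unit `ε` is the component
`η_E` of the unit of the monad and `κ` is compatible with the unit and the multiplication of the
monad. -/
class IsMonoidal {C : Type u} [Category.{v} C] [MonoidalCategory C] (T : CategoryTheory.Monad C)
    [T.toFunctor.LaxMonoidal] : Prop where
  ε_eq : Functor.LaxMonoidal.ε T.toFunctor = T.η.app (𝟙_ C)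
  mul_compat (X Y : C) :
    Functor.LaxMonoidal.μ T.toFunctor (T.obj X) (T.obj Y) ≫
        T.map (Functor.LaxMonoidal.μ T.toFunctor X Y) ≫ T.μ.app (X ⊗ Y) =
      (T.μ.app X ⊗ₘ T.μ.app Y) ≫ Functor.LaxMonoidal.μ T.toFunctor X Y
  unit_compat (X Y : C) :
    (T.η.app X ⊗ₘ T.η.app Y) ≫ Functor.LaxMonoidal.μ T.toFunctor X Y = T.η.app (X ⊗ Y)

/-- The monoidal monad is *symmetric* if `κ` commutes with the symmetry of `C`. -/
def IsSymmetric {C : Type u} [Category.{v} C] [MonoidalCategory C] [SymmetricCategory C]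
    (T : CategoryTheory.Monad C) [T.toFunctor.LaxMonoidal] : Prop :=
  ∀ X Y : C,
    (β_ (T.obj X) (T.obj Y)).hom ≫ Functor.LaxMonoidal.μ T.toFunctor Y X =
      Functor.LaxMonoidal.μ T.toFunctor X Y ≫ T.map (β_ X Y).hom

section

set_option linter.unusedSectionVars false

variable {C : Type u} [Category.{v} C] [MonoidalCategory C] {T : CategoryTheory.Monad C}
  [T.toFunctor.LaxMonoidal]

variable (T) in
/-- The tensorator `κ X Y : T X ⊗ T Y ⟶ T (X ⊗ Y)`. -/
abbrev kap (X Y : C) : T.obj X ⊗ T.obj Y ⟶ T.obj (X ⊗ Y) :=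
  Functor.LaxMonoidal.μ T.toFunctor X Y

variable (T) in
/-- The component `η_X` of the unit, as a morphism into the carrier of the free algebra. -/
def unitMap (X : C) : X ⟶ (T.free.obj X).A := T.η.app X

/-- The morphism `μ · T κ : T (T A ⊗ T B) ⟶ T (A ⊗ B)` of free `T`-algebras. -/
def pairFst (A B : T.Algebra) :
    T.free.obj (T.obj A.A ⊗ T.obj B.A) ⟶ T.free.obj (A.A ⊗ B.A) where
  f := T.map (kap T A.A B.A) ≫ T.μ.app (A.A ⊗ B.A)
  h := by
    change T.map (T.map (kap T A.A B.A) ≫ T.μ.app (A.A ⊗ B.A)) ≫ T.μ.app (A.A ⊗ B.A) =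
      T.μ.app (T.obj A.A ⊗ T.obj B.A) ≫ T.map (kap T A.A B.A) ≫ T.μ.app (A.A ⊗ B.A)
    rw [Functor.map_comp, Category.assoc, T.assoc, T.mu_naturality_assoc]

/-- The morphism `T (a ⊗ b) : T (T A ⊗ T B) ⟶ T (A ⊗ B)` of free `T`-algebras. -/
def pairSnd (A B : T.Algebra) :
    T.free.obj (T.obj A.A ⊗ T.obj B.A) ⟶ T.free.obj (A.A ⊗ B.A) :=
  T.free.map (A.a ⊗ₘ B.a)

variable (T) in
/-- A choice of a tensor product `q A B : T (A ⊗ B) ⟶ A ⊠ B` for any two `T`-algebras `A`, `B`, that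
is, of a coequalizer in the category of `T`-algebras of `μ · T κ` and `T (a ⊗ b)`. -/
structure TensorProducts where
  obj (A B : T.Algebra) : T.Algebra
  q (A B : T.Algebra) : T.free.obj (A.A ⊗ B.A) ⟶ obj A B
  condition (A B : T.Algebra) : pairFst A B ≫ q A B = pairSnd A B ≫ q A B
  isColimit (A B : T.Algebra) : IsColimit (Cofork.ofπ (q A B) (condition A B))

lemma pairFst_naturality {A A' B B' : T.Algebra} (g : A ⟶ A') (h : B ⟶ B') :
    pairFst A B ≫ T.free.map (g.f ⊗ₘ h.f) =
      T.free.map (T.map g.f ⊗ₘ T.map h.f) ≫ pairFst A' B' := by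
  ext
  change (T.map (kap T A.A B.A) ≫ T.μ.app (A.A ⊗ B.A)) ≫ T.map (g.f ⊗ₘ h.f) =
    T.map (T.map g.f ⊗ₘ T.map h.f) ≫ T.map (kap T A'.A B'.A) ≫ T.μ.app (A'.A ⊗ B'.A)
  rw [Category.assoc, ← T.mu_naturality, ← Functor.map_comp_assoc, ← Functor.map_comp_assoc,
    Functor.LaxMonoidal.μ_natural]

lemma pairSnd_naturality {A A' B B' : T.Algebra} (g : A ⟶ A') (h : B ⟶ B') :
    pairSnd A B ≫ T.free.map (g.f ⊗ₘ h.f) =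
      T.free.map (T.map g.f ⊗ₘ T.map h.f) ≫ pairSnd A' B' := by
  simp only [pairSnd, ← Functor.map_comp, tensorHom_comp_tensorHom, Monad.Algebra.Hom.h]

namespace TensorProducts

variable (D : TensorProducts T)

/-- The morphism `g ⊠ h`, the unique one with `(g ⊠ h) · q = q · T (g ⊗ h)`. -/
def map {A A' B B' : T.Algebra} (g : A ⟶ A') (h : B ⟶ B') : D.obj A B ⟶ D.obj A' B' :=
  Cofork.IsColimit.desc (D.isColimit A B) (T.free.map (g.f ⊗ₘ h.f) ≫ D.q A' B') (by
    rw [← Category.assoc, ← Category.assoc, pairFst_naturality, pairSnd_naturality,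
      Category.assoc, Category.assoc, D.condition])

lemma q_map {A A' B B' : T.Algebra} (g : A ⟶ A') (h : B ⟶ B') :
    D.q A B ≫ D.map g h = T.free.map (g.f ⊗ₘ h.f) ≫ D.q A' B' :=
  Cofork.IsColimit.π_desc' (D.isColimit A B) _ _

/-- The composite `A ⊗ B ⟶ T (A ⊗ B) ⟶ A ⊠ B` of `η` and `q` (the universal bimorphism). -/
def bim (A B : T.Algebra) : A.A ⊗ B.A ⟶ (D.obj A B).A :=
  unitMap T (A.A ⊗ B.A) ≫ (D.q A B).f

/-- The identification `T (X ⊗ Y) ⟶ T X ⊠ T Y`, inverse to the morphism induced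
by `μ · T κ`. -/
def freeComparison (X Y : C) :
    T.free.obj (X ⊗ Y) ⟶ D.obj (T.free.obj X) (T.free.obj Y) :=
  T.free.map (unitMap T X ⊗ₘ unitMap T Y) ≫ D.q (T.free.obj X) (T.free.obj Y)

/-- The structure map `a : T A ⟶ A` of a `T`-algebra, as a morphism of `T`-algebras. -/
def structureMap (A : T.Algebra) : T.free.obj A.A ⟶ A where
  f := A.a
  h := A.assoc.symm

/-- The morphism `q · T (q · η ⊗ 1) : T ((A ⊗ B) ⊗ C) ⟶ (A ⊠ B) ⊠ C`. Under the identification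
`T ((A ⊗ B) ⊗ C) ≅ T (A ⊗ B) ⊠ T C` it is `q ⊠ c`, see `qLeft_eq`. -/
def qLeft (A B C : T.Algebra) :
    T.free.obj ((A.A ⊗ B.A) ⊗ C.A) ⟶ D.obj (D.obj A B) C :=
  T.free.map (D.bim A B ▷ C.A) ≫ D.q (D.obj A B) C

/-- The morphism `q · T (1 ⊗ q · η) : T (A ⊗ (B ⊗ C)) ⟶ A ⊠ (B ⊠ C)`. Under the identification
`T (A ⊗ (B ⊗ C)) ≅ T A ⊠ T (B ⊗ C)` it is `a ⊠ q`, see `qRight_eq`. -/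
def qRight (A B C : T.Algebra) :
    T.free.obj (A.A ⊗ (B.A ⊗ C.A)) ⟶ D.obj A (D.obj B C) :=
  T.free.map (A.A ◁ D.bim B C) ≫ D.q A (D.obj B C)

lemma freeComparison_map {X Y : C} {A B : T.Algebra} (g : T.free.obj X ⟶ A)
    (h : T.free.obj Y ⟶ B) :
    D.freeComparison X Y ≫ D.map g h =
      T.free.map ((unitMap T X ≫ g.f) ⊗ₘ (unitMap T Y ≫ h.f)) ≫ D.q A B := by
  rw [freeComparison, Category.assoc, D.q_map, ← Category.assoc, ← Functor.map_comp,
    tensorHom_comp_tensorHom]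

lemma qLeft_eq (A B C : T.Algebra) :
    D.qLeft A B C =
      D.freeComparison (A.A ⊗ B.A) C.A ≫ D.map (D.q A B) (structureMap C) := by
  rw [freeComparison_map, show unitMap T C.A ≫ (structureMap C).f = 𝟙 C.A from C.unit,
    tensorHom_id, qLeft, bim]

lemma qRight_eq (A B C : T.Algebra) :
    D.qRight A B C =
      D.freeComparison A.A (B.A ⊗ C.A) ≫ D.map (structureMap A) (D.q B C) := by
  rw [freeComparison_map, show unitMap T A.A ≫ (structureMap A).f = 𝟙 A.A from A.unit,
    id_tensorHom, qRight, bim]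

/-- The bimorphism `a · T λ · κ · (1 ⊗ η) : T E ⊗ A ⟶ A`. -/
def leftUnitBim (A : T.Algebra) : (T.free.obj (𝟙_ C)).A ⊗ A.A ⟶ A.A :=
  (T.obj (𝟙_ C) ◁ T.η.app A.A) ≫ kap T (𝟙_ C) A.A ≫ T.map (λ_ A.A).hom ≫ A.a

/-- The bimorphism `a · T ρ · κ · (η ⊗ 1) : A ⊗ T E ⟶ A`. -/
def rightUnitBim (A : T.Algebra) : A.A ⊗ (T.free.obj (𝟙_ C)).A ⟶ A.A :=
  (T.η.app A.A ▷ T.obj (𝟙_ C)) ≫ kap T A.A (𝟙_ C) ≫ T.map (ρ_ A.A).hom ≫ A.a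

/-- Associativity and unit isomorphisms for `⊠` and `T E` that are induced by those of `C`: each
one satisfies the defining square
`assoc · (q ⊠ c) = (a ⊠ q) · T α`,
`left · q = a · T (a · T λ · κ · (1 ⊗ η))`,
`right · q = a · T (a · T ρ · κ · (η ⊗ 1))`. -/
structure InducedConstraints where
  assoc (A B C : T.Algebra) : D.obj (D.obj A B) C ≅ D.obj A (D.obj B C)
  left (A : T.Algebra) : D.obj (T.free.obj (𝟙_ C)) A ≅ A
  right (A : T.Algebra) : D.obj A (T.free.obj (𝟙_ C)) ≅ A
  assoc_spec (A B C : T.Algebra) :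
    D.qLeft A B C ≫ (assoc A B C).hom = T.free.map (α_ A.A B.A C.A).hom ≫ D.qRight A B C
  left_spec (A : T.Algebra) :
    D.q (T.free.obj (𝟙_ C)) A ≫ (left A).hom =
      T.free.map (leftUnitBim A) ≫ structureMap A
  right_spec (A : T.Algebra) :
    D.q A (T.free.obj (𝟙_ C)) ≫ (right A).hom =
      T.free.map (rightUnitBim A) ≫ structureMap A

variable {D}

/-- The data `(⊠, T E, assoc, left, right)` on the category of `T`-algebras. -/
@[reducible]
def InducedConstraints.toStruct (S : D.InducedConstraints) :
    MonoidalCategoryStruct T.Algebra where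
  tensorObj := D.obj
  whiskerLeft A _ _ h := D.map (𝟙 A) h
  whiskerRight g B := D.map g (𝟙 B)
  tensorHom := D.map
  tensorUnit := T.free.obj (𝟙_ C)
  associator := S.assoc
  leftUnitor := S.left
  rightUnitor := S.right

variable (D)

/-- Symmetry isomorphisms for `⊠` that are induced by those of `C`: they satisfy the
defining square `sym · q = q · T σ`. -/
structure InducedSymmetry [SymmetricCategory C] where
  sym (A B : T.Algebra) : D.obj A B ≅ D.obj B A
  sym_spec (A B : T.Algebra) :
    D.q A B ≫ (sym A B).hom = T.free.map (β_ A.A B.A).hom ≫ D.q B A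

end TensorProducts

end

/-- The given data satisfy the axioms of a monoidal category. -/
def IsMonoidalCategory {X : Type u} [Category.{v} X] (S : MonoidalCategoryStruct X) : Prop :=
  ∃ M : MonoidalCategory X, M.toMonoidalCategoryStruct = S

/-- The given data satisfy the axioms of a symmetric monoidal category. -/
def IsSymmetricMonoidalCategory {X : Type u} [Category.{v} X] (S : MonoidalCategoryStruct X)
    (σ : ∀ A B : X, S.tensorObj A B ≅ S.tensorObj B A) : Prop :=
  ∃ (M : MonoidalCategory X) (B : SymmetricCategory X),
    (⟨M.toMonoidalCategoryStruct, B.braiding⟩ :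
      Σ S' : MonoidalCategoryStruct X, ∀ A B : X, S'.tensorObj A B ≅ S'.tensorObj B A) = ⟨S, σ⟩

end MonoidalMonad

/-! The object `A ⊠ B` represents bimorphisms `A ⊗ B ⟶ X`, as the tensor product of modules does: a
morphism `T (A ⊗ B) ⟶ X` of algebras is a morphism `A ⊗ B ⟶ X` in the base, and it coequalizes the
defining pair exactly when the latter is bilinear. All constraints and axioms are therefore
statements about the universal bimorphisms `bim`, where they reduce to the corresponding facts in
`C`.

The difficulty is iteration. The defining pair is reflexive in `C` and `T ≅ T (E ⊗ -)` preserves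
reflexive coequalizers, so the forgetful functor creates the coequalizer and `q` is a coequalizer in
`C`. Neither `q ⊗ Y` nor `Y ⊗ q` need be one, but both become coequalizers after applying `T`. Since
a morphism into the carrier of an algebra extends along `η` to a morphism out of `T`, this suffices
to cancel and to factor morphisms with such targets (`map_coequalizer_hom_ext`,
`map_coequalizer_desc`). Hence trimorphisms factor through bimorphisms on `(A ⊠ B) ⊗ Z` and on `A ⊗
(B ⊠ Z)` (`exists_isBilinear_left`, `exists_isBilinear_right`), both triple products represent
trimorphisms, and the associator follows.

Bilinearity is checked one variable at a time, through the one-variable extensions `extLeft` and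
`extRight`; these commute because `κ` is compatible with `μ`. For the units, a bimorphism on `T E ⊗
A` is determined by its restriction along `η_E` to `E ⊗ A ≅ A`. -/

namespace MonoidalMonad

/-! ### Extension of morphisms along the unit of a monad -/

section Monad

variable {C : Type u} [Category.{v} C] (T : CategoryTheory.Monad C)

/-- The unit of a monad, as a morphism `X ⟶ T X`. -/
def eta (X : C) : X ⟶ T.obj X := T.η.app X

/-- The multiplication of a monad, as a morphism `T (T X) ⟶ T X`. -/
def mu (X : C) : T.obj (T.obj X) ⟶ T.obj X := T.μ.app X

lemma eta_naturality {X Y : C} (f : X ⟶ Y) : f ≫ eta T Y = eta T X ≫ T.map f :=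
  T.η.naturality f

lemma mu_naturality {X Y : C} (f : X ⟶ Y) : T.map (T.map f) ≫ mu T Y = mu T X ≫ T.map f :=
  T.μ.naturality f

lemma eta_mu (X : C) : eta T (T.obj X) ≫ mu T X = 𝟙 (T.obj X) := T.left_unit X

lemma map_eta_mu (X : C) : T.map (eta T X) ≫ mu T X = 𝟙 (T.obj X) := T.right_unit X

variable {T}

lemma eta_a (X : T.Algebra) : eta T X.A ≫ X.a = 𝟙 X.A := X.unit

lemma mu_a (X : T.Algebra) : mu T X.A ≫ X.a = T.map X.a ≫ X.a := X.assoc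

lemma eta_map_a {Y : C} {X : T.Algebra} (f : Y ⟶ X.A) : eta T Y ≫ T.map f ≫ X.a = f := by
  rw [← reassoc_of% eta_naturality, eta_a, Category.comp_id]

lemma map_comp_map_a {W Y : C} {X : T.Algebra} (u : W ⟶ T.obj Y) (f : Y ⟶ X.A) :
    T.map (u ≫ T.map f ≫ X.a) ≫ X.a = T.map u ≫ mu T Y ≫ T.map f ≫ X.a := by
  rw [Functor.map_comp_assoc, Functor.map_comp_assoc, ← mu_a, reassoc_of% mu_naturality]

lemma map_eta_comp_a {Y : C} {X : T.Algebra} {l : T.obj Y ⟶ X.A}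
    (hl : T.map l ≫ X.a = mu T Y ≫ l) : T.map (eta T Y ≫ l) ≫ X.a = l := by
  rw [Functor.map_comp_assoc, hl, reassoc_of% map_eta_mu]

lemma free_hom_ext {Y : C} {X : T.Algebra} {f g : T.free.obj Y ⟶ X}
    (h : eta T Y ≫ f.f = eta T Y ≫ g.f) : f = g := by
  ext
  exact (map_eta_comp_a f.h).symm.trans
    ((congrArg (fun k => T.map k ≫ X.a) h).trans (map_eta_comp_a g.h))

end Monad

/-! ### Reflexive coequalizers tested on carriers of algebras -/

section ReflexiveCoequalizers

variable {C : Type u} [Category.{v} C] {T : CategoryTheory.Monad C}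

lemma isReflexivePair_map {D : Type*} [Category* D] (G : C ⥤ D) {R P : C} (r s : R ⟶ P)
    [IsReflexivePair r s] : IsReflexivePair (G.map r) (G.map s) :=
  .mk' (G.map (commonSection r s)) (by rw [← G.map_comp, section_comp_left, G.map_id])
    (by rw [← G.map_comp, section_comp_right, G.map_id])

/-- If `G ⋙ T` preserves a reflexive coequalizer `p`, then `G p` is an epimorphism with respect to
morphisms into carriers of `T`-algebras. -/
lemma map_coequalizer_hom_ext (G : C ⥤ C)
    [Monad.PreservesColimitOfIsReflexivePair (G ⋙ T.toFunctor)]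
    {R P Q : C} {r s : R ⟶ P} [IsReflexivePair r s] {p : P ⟶ Q} {w : r ≫ p = s ≫ p}
    (hp : IsColimit (Cofork.ofπ p w)) {X : T.Algebra} {k k' : G.obj Q ⟶ X.A}
    (h : G.map p ≫ k = G.map p ≫ k') : k = k' := by
  have hc := isColimitCoforkMapOfIsColimit (G ⋙ T.toFunctor) w hp
  -- The hypothesis only concerns `T (G p)`, so `k` and `k'` are compared through their extensions
  -- to `T (G Q)`; restricting along `η` recovers them.
  have key : T.map k ≫ X.a = T.map k' ≫ X.a := by
    refine Cofork.IsColimit.hom_ext hc ?_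
    change T.map (G.map p) ≫ T.map k ≫ X.a = T.map (G.map p) ≫ T.map k' ≫ X.a
    rw [← Functor.map_comp_assoc, h, Functor.map_comp_assoc]
  simpa only [eta_map_a] using eta T _ ≫= key

/-- If `G ⋙ T` preserves a reflexive coequalizer `p` of `r` and `s`, then morphisms into carriers of
`T`-algebras that coequalize `G r` and `G s` factor through `G p`. -/
lemma map_coequalizer_desc (G : C ⥤ C)
    [Monad.PreservesColimitOfIsReflexivePair (G ⋙ T.toFunctor)]
    {R P Q : C} {r s : R ⟶ P} [IsReflexivePair r s] {p : P ⟶ Q} {w : r ≫ p = s ≫ p}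
    (hp : IsColimit (Cofork.ofπ p w)) {X : T.Algebra} (g : G.obj P ⟶ X.A)
    (h : G.map r ≫ g = G.map s ≫ g) : ∃ k : G.obj Q ⟶ X.A, G.map p ≫ k = g := by
  have hc := isColimitCoforkMapOfIsColimit (G ⋙ T.toFunctor) w hp
  obtain ⟨l, hl⟩ := Cofork.IsColimit.desc' hc (T.map g ≫ X.a) (by
    change T.map (G.map r) ≫ T.map g ≫ X.a = T.map (G.map s) ≫ T.map g ≫ X.a
    rw [← Functor.map_comp_assoc, h, Functor.map_comp_assoc])
  replace hl : T.map (G.map p) ≫ l = T.map g ≫ X.a := hl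
  exact ⟨eta T _ ≫ l, by rw [reassoc_of% eta_naturality, hl, eta_map_a]⟩

/-- The forgetful functor creates coequalizers of pairs whose underlying pair is reflexive, if
`T` preserves reflexive coequalizers. -/
@[reducible]
noncomputable def createsReflexiveCoequalizer
    [Monad.PreservesColimitOfIsReflexivePair T.toFunctor]
    {A B : T.Algebra} (f g : A ⟶ B) [IsReflexivePair f.f g.f] :
    CreatesColimit (parallelPair f g) T.forget :=
  have e : parallelPair f g ⋙ T.forget ≅ parallelPair f.f g.f := diagramIsoParallelPair _
  have e' : (parallelPair f g ⋙ T.forget) ⋙ T.toFunctor ≅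
      parallelPair (T.map f.f) (T.map g.f) := diagramIsoParallelPair _
  -- Creation requires `T` to preserve the coequalizer of the underlying pair and also that of its
  -- image under `T`; the image pair is again reflexive.
  have : IsReflexivePair (T.map f.f) (T.map g.f) := isReflexivePair_map T.toFunctor _ _
  have : PreservesColimit (parallelPair f g ⋙ T.forget) T.toFunctor :=
    preservesColimit_of_iso_diagram _ e.symm
  have : PreservesColimit ((parallelPair f g ⋙ T.forget) ⋙ T.toFunctor) T.toFunctor :=
    preservesColimit_of_iso_diagram _ e'.symm
  inferInstance

lemma hasCoequalizer_of_isReflexivePair [HasReflexiveCoequalizers C]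
    [Monad.PreservesColimitOfIsReflexivePair T.toFunctor]
    {A B : T.Algebra} (f g : A ⟶ B) [IsReflexivePair f.f g.f] : HasCoequalizer f g :=
  have := createsReflexiveCoequalizer f g
  have : HasColimit (parallelPair f.f g.f) := HasReflexiveCoequalizers.has_coeq f.f g.f
  have e : parallelPair f g ⋙ T.forget ≅ parallelPair f.f g.f := diagramIsoParallelPair _
  have : HasColimit (parallelPair f g ⋙ T.forget) := hasColimit_of_iso e
  hasColimit_of_created _ T.forget

/-- The underlying cofork of a coequalizer of `T`-algebras is a coequalizer, if the underlying
pair is reflexive. -/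
noncomputable def isColimitForgetCofork [HasReflexiveCoequalizers C]
    [Monad.PreservesColimitOfIsReflexivePair T.toFunctor]
    {A B Q : T.Algebra} {f g : A ⟶ B} [IsReflexivePair f.f g.f] {q : B ⟶ Q}
    {w : f ≫ q = g ≫ q} (hq : IsColimit (Cofork.ofπ q w)) :
    IsColimit (Cofork.ofπ (f := f.f) (g := g.f) q.f (congrArg Monad.Algebra.Hom.f w)) :=
  have := createsReflexiveCoequalizer f g
  have : HasColimit (parallelPair f.f g.f) := HasReflexiveCoequalizers.has_coeq f.f g.f
  have e : parallelPair f g ⋙ T.forget ≅ parallelPair f.f g.f := diagramIsoParallelPair _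
  have : HasColimit (parallelPair f g ⋙ T.forget) := hasColimit_of_iso e
  isColimitCoforkMapOfIsColimit T.forget w hq

end ReflexiveCoequalizers

section Preservation

variable {C : Type u} [Category.{v} C] [MonoidalCategory C] (T : CategoryTheory.Monad C)

/-- The left unitor gives `T (E ⊗ -) ≅ T`, so preservation by `T` itself is a case of the hypothesis
on `T (X ⊗ -)`. -/
lemma preservesColimitOfIsReflexivePair_of_tensorLeft
    [Monad.PreservesColimitOfIsReflexivePair (tensorLeft (𝟙_ C) ⋙ T.toFunctor)] :
    Monad.PreservesColimitOfIsReflexivePair T.toFunctor where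
  out _ _ f g _ := preservesColimit_of_natIso (K := parallelPair f g)
    (Functor.isoWhiskerRight (leftUnitorNatIso C) T.toFunctor ≪≫ T.toFunctor.leftUnitor)

end Preservation

/-! ### One-variable linear extensions and their interchange -/

section Extension

open Functor.LaxMonoidal

variable {C : Type u} [Category.{v} C] [MonoidalCategory C] {T : CategoryTheory.Monad C}
  [T.toFunctor.LaxMonoidal]

/-- The extension of `f : W ⊗ Y ⟶ X` to `T W ⊗ Y`, linear in the first variable. -/
def extLeft {W Y : C} {X : T.Algebra} (f : W ⊗ Y ⟶ X.A) : T.obj W ⊗ Y ⟶ X.A :=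
  T.obj W ◁ eta T Y ≫ kap T W Y ≫ T.map f ≫ X.a

/-- The extension of `f : Y ⊗ W ⟶ X` to `Y ⊗ T W`, linear in the second variable. -/
def extRight {W Y : C} {X : T.Algebra} (f : Y ⊗ W ⟶ X.A) : Y ⊗ T.obj W ⟶ X.A :=
  eta T Y ▷ T.obj W ≫ kap T Y W ≫ T.map f ≫ X.a

section Naturality

variable {W W' Y Y' : C} {X X' : T.Algebra}

lemma map_whiskerRight_extLeft (w : W ⟶ W') (f : W' ⊗ Y ⟶ X.A) :
    T.map w ▷ Y ≫ extLeft f = extLeft (w ▷ Y ≫ f) := by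
  rw [extLeft, extLeft, ← whisker_exchange_assoc, μ_natural_left_assoc, Functor.map_comp_assoc]

lemma whiskerLeft_extLeft (y : Y ⟶ Y') (f : W ⊗ Y' ⟶ X.A) :
    T.obj W ◁ y ≫ extLeft f = extLeft (W ◁ y ≫ f) := by
  rw [extLeft, extLeft, ← whiskerLeft_comp_assoc, eta_naturality, whiskerLeft_comp_assoc,
    μ_natural_right_assoc, Functor.map_comp_assoc]

lemma whiskerLeft_map_extRight (w : W ⟶ W') (f : Y ⊗ W' ⟶ X.A) :
    Y ◁ T.map w ≫ extRight f = extRight (Y ◁ w ≫ f) := by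
  rw [extRight, extRight, whisker_exchange_assoc, μ_natural_right_assoc, Functor.map_comp_assoc]

lemma whiskerRight_extRight (y : Y ⟶ Y') (f : Y' ⊗ W ⟶ X.A) :
    y ▷ T.obj W ≫ extRight f = extRight (y ▷ W ≫ f) := by
  rw [extRight, extRight, ← comp_whiskerRight_assoc, eta_naturality, comp_whiskerRight_assoc,
    μ_natural_left_assoc, Functor.map_comp_assoc]

lemma extLeft_comp (f : W ⊗ Y ⟶ X.A) (g : X ⟶ X') : extLeft f ≫ g.f = extLeft (f ≫ g.f) := by
  simp only [extLeft, Category.assoc, ← g.h, Functor.map_comp]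

lemma extRight_comp (f : Y ⊗ W ⟶ X.A) (g : X ⟶ X') : extRight f ≫ g.f = extRight (f ≫ g.f) := by
  simp only [extRight, Category.assoc, ← g.h, Functor.map_comp]

end Naturality

section IsMonoidal

variable [IsMonoidal T]

lemma kap_mu (X Y : C) : kap T (T.obj X) (T.obj Y) ≫ T.map (kap T X Y) ≫ mu T (X ⊗ Y) =
    (mu T X ⊗ₘ mu T Y) ≫ kap T X Y := IsMonoidal.mul_compat X Y

lemma eta_kap (X Y : C) : (eta T X ⊗ₘ eta T Y) ≫ kap T X Y = eta T (X ⊗ Y) :=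
  IsMonoidal.unit_compat X Y

variable {W Y : C} {X : T.Algebra}

lemma eta_extLeft (f : W ⊗ Y ⟶ X.A) : eta T W ▷ Y ≫ extLeft f = f := by
  rw [extLeft, ← tensorHom_def_assoc, reassoc_of% eta_kap, eta_map_a]

lemma eta_extRight (f : Y ⊗ W ⟶ X.A) : Y ◁ eta T W ≫ extRight f = f := by
  rw [extRight, ← tensorHom_def'_assoc, reassoc_of% eta_kap, eta_map_a]

/-- The unique extension of `f : W ⊗ Y ⟶ X` to `T W ⊗ T Y` that is linear in both variables. -/
lemma extLeft_extRight (f : W ⊗ Y ⟶ X.A) :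
    extLeft (extRight f) = kap T W Y ≫ T.map f ≫ X.a := by
  rw [extLeft, extRight, ← Category.assoc (eta T W ▷ _), map_comp_map_a, Functor.map_comp_assoc,
    ← μ_natural_left_assoc, reassoc_of% kap_mu, ← tensorHom_def'_assoc,
    tensorHom_comp_tensorHom_assoc, map_eta_mu, eta_mu, id_tensorHom_id, Category.id_comp]

/-- With `extLeft_extRight` this says that the order of the two extensions is immaterial:
compatibility of `κ` with `μ` turns either order into the joint extension. -/
lemma extRight_extLeft (f : W ⊗ Y ⟶ X.A) :
    extRight (extLeft f) = kap T W Y ≫ T.map f ≫ X.a := by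
  rw [extLeft, extRight, ← Category.assoc (T.obj W ◁ _), map_comp_map_a, Functor.map_comp_assoc,
    ← μ_natural_right_assoc, reassoc_of% kap_mu, ← tensorHom_def_assoc,
    tensorHom_comp_tensorHom_assoc, map_eta_mu, eta_mu, id_tensorHom_id, Category.id_comp]

/-- This is linearity of `extLeft f` in its first variable, for the free algebra on `W`. -/
lemma mu_whiskerRight_extLeft (f : W ⊗ Y ⟶ X.A) :
    mu T W ▷ Y ≫ extLeft f = extLeft (extLeft f) := by
  rw [extLeft, extLeft, ← Category.assoc (T.obj W ◁ _), map_comp_map_a, Functor.map_comp_assoc,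
    ← μ_natural_right_assoc, reassoc_of% kap_mu, tensorHom_def'_assoc, ← whiskerLeft_comp_assoc,
    ← whiskerLeft_comp_assoc, Category.assoc (eta T Y), map_eta_mu, Category.comp_id,
    whisker_exchange_assoc, Category.assoc]

lemma whiskerLeft_mu_extRight (f : Y ⊗ W ⟶ X.A) :
    Y ◁ mu T W ≫ extRight f = extRight (extRight f) := by
  rw [extRight, extRight, ← Category.assoc (_ ▷ T.obj W), map_comp_map_a, Functor.map_comp_assoc,
    ← μ_natural_left_assoc, reassoc_of% kap_mu, tensorHom_def_assoc, ← comp_whiskerRight_assoc,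
    ← comp_whiskerRight_assoc, Category.assoc (eta T Y), map_eta_mu, Category.comp_id,
    ← whisker_exchange_assoc, Category.assoc]

end IsMonoidal

end Extension

/-! ### Linear maps, bimorphisms and trimorphisms -/

section Multilinear

open Functor.LaxMonoidal

variable {C : Type u} [Category.{v} C] [MonoidalCategory C] {T : CategoryTheory.Monad C}
  [T.toFunctor.LaxMonoidal]

/-- A morphism `Z ⊗ Y ⟶ X` is linear in the first variable. -/
def IsLinearLeft {Z X : T.Algebra} {Y : C} (f : Z.A ⊗ Y ⟶ X.A) : Prop :=
  extLeft f = Z.a ▷ Y ≫ f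

/-- A morphism `Y ⊗ Z ⟶ X` is linear in the second variable. -/
def IsLinearRight {Z X : T.Algebra} {Y : C} (f : Y ⊗ Z.A ⟶ X.A) : Prop :=
  extRight f = Y ◁ Z.a ≫ f

/-- A morphism `A ⊗ B ⟶ X` is a bimorphism of `T`-algebras. -/
def IsBilinear {A B X : T.Algebra} (f : A.A ⊗ B.A ⟶ X.A) : Prop :=
  kap T A.A B.A ≫ T.map f ≫ X.a = (A.a ⊗ₘ B.a) ≫ f

/-- A morphism `(A ⊗ B) ⊗ C ⟶ X` is a trimorphism of `T`-algebras. -/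
def IsTrilinearLeft {A B Z X : T.Algebra} (f : (A.A ⊗ B.A) ⊗ Z.A ⟶ X.A) : Prop :=
  kap T A.A B.A ▷ T.obj Z.A ≫ kap T (A.A ⊗ B.A) Z.A ≫ T.map f ≫ X.a =
    ((A.a ⊗ₘ B.a) ⊗ₘ Z.a) ≫ f

/-- A morphism `A ⊗ (B ⊗ C) ⟶ X` is a trimorphism of `T`-algebras. -/
def IsTrilinearRight {A B Z X : T.Algebra} (f : A.A ⊗ (B.A ⊗ Z.A) ⟶ X.A) : Prop :=
  T.obj A.A ◁ kap T B.A Z.A ≫ kap T A.A (B.A ⊗ Z.A) ≫ T.map f ≫ X.a =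
    (A.a ⊗ₘ (B.a ⊗ₘ Z.a)) ≫ f

variable {A B Z X Y : T.Algebra}

namespace IsBilinear

lemma isLinearLeft {f : A.A ⊗ B.A ⟶ X.A} (hf : IsBilinear f) : IsLinearLeft f := by
  unfold IsLinearLeft extLeft
  rw [hf, tensorHom_def'_assoc, ← whiskerLeft_comp_assoc, eta_a, whiskerLeft_id,
    Category.id_comp]

lemma isLinearRight {f : A.A ⊗ B.A ⟶ X.A} (hf : IsBilinear f) : IsLinearRight f := by
  unfold IsLinearRight extRight
  rw [hf, tensorHom_def_assoc, ← comp_whiskerRight_assoc, eta_a, id_whiskerRight,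
    Category.id_comp]

/-- The joint extension is obtained by extending in one variable after the other, and each
hypothesis evaluates one of the two extensions. -/
lemma of_isLinear [IsMonoidal T] {f : A.A ⊗ B.A ⟶ X.A} (hl : IsLinearLeft f)
    (hr : IsLinearRight f) : IsBilinear f := by
  unfold IsBilinear
  rw [← extLeft_extRight, hr, ← whiskerLeft_extLeft, hl, tensorHom_def'_assoc]

lemma comp {f : A.A ⊗ B.A ⟶ X.A} (hf : IsBilinear f) (g : X ⟶ Y) : IsBilinear (f ≫ g.f) := by
  unfold IsBilinear at hf ⊢
  rw [Functor.map_comp_assoc, g.h, reassoc_of% hf]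

end IsBilinear

/-- A morphism on `T W ⊗ Y` that is linear in the first variable is determined by its restriction
to `W ⊗ Y`. -/
lemma IsLinearLeft.free_hom_ext {V W : C} {k k' : T.obj V ⊗ W ⟶ X.A}
    (hk : IsLinearLeft (Z := T.free.obj V) k) (hk' : IsLinearLeft (Z := T.free.obj V) k')
    (h : eta T V ▷ W ≫ k = eta T V ▷ W ≫ k') : k = k' := by
  have key (l : T.obj V ⊗ W ⟶ X.A) (hl : extLeft l = mu T V ▷ W ≫ l) :
      extLeft (eta T V ▷ W ≫ l) = l := by
    rw [← map_whiskerRight_extLeft, hl, ← comp_whiskerRight_assoc, map_eta_mu, id_whiskerRight,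
      Category.id_comp]
  rw [← key k hk, h, key k' hk']

/-- A morphism on `Y ⊗ T W` that is linear in the second variable is determined by its restriction
to `Y ⊗ W`. -/
lemma IsLinearRight.free_hom_ext {V W : C} {k k' : W ⊗ T.obj V ⟶ X.A}
    (hk : IsLinearRight (Z := T.free.obj V) k) (hk' : IsLinearRight (Z := T.free.obj V) k')
    (h : W ◁ eta T V ≫ k = W ◁ eta T V ≫ k') : k = k' := by
  have key (l : W ⊗ T.obj V ⟶ X.A) (hl : extRight l = W ◁ mu T V ≫ l) :
      extRight (W ◁ eta T V ≫ l) = l := by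
    rw [← whiskerLeft_map_extRight, hl, ← whiskerLeft_comp_assoc, map_eta_mu, whiskerLeft_id,
      Category.id_comp]
  rw [← key k hk, h, key k' hk']

/-- Linear maps compose: if `f : A ⊗ V ⟶ X` and `g : X ⊗ W ⟶ Z` are linear in the first variable,
so is the induced morphism `A ⊗ (V ⊗ W) ⟶ Z`. -/
lemma IsLinearLeft.whiskerRight_comp [IsMonoidal T] {V W : C} {f : A.A ⊗ V ⟶ X.A}
    (hf : IsLinearLeft f) {g : X.A ⊗ W ⟶ Z.A} (hg : IsLinearLeft g) :
    IsLinearLeft ((α_ A.A V W).inv ≫ f ▷ W ≫ g) := by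
  unfold IsLinearLeft at hf hg ⊢
  -- Extending past `V ⊗ W` amounts to extending past `V` and then past `W`: split `η_{V ⊗ W}` as `κ
  -- · (η ⊗ η)` and use associativity of `κ`.
  have h : T.obj A.A ◁ eta T (V ⊗ W) ≫ kap T A.A (V ⊗ W) ≫ T.map (α_ A.A V W).inv =
      (α_ _ _ _).inv ≫ (T.obj A.A ◁ eta T V ≫ kap T A.A V) ▷ W ≫
        T.obj (A.A ⊗ V) ◁ eta T W ≫ kap T (A.A ⊗ V) W := by
    rw [← eta_kap, whiskerLeft_comp_assoc, associativity_inv, MonoidalCategory.tensorHom_def,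
      whiskerLeft_comp_assoc, comp_whiskerRight_assoc, ← whisker_exchange_assoc,
      associator_inv_naturality_right_assoc, associator_inv_naturality_middle_assoc]
  have h' := h =≫ (T.map (f ▷ W ≫ g) ≫ Z.a)
  simp only [Category.assoc] at h'
  rw [extLeft, Functor.map_comp_assoc, h', ← extLeft, ← map_whiskerRight_extLeft, hg,
    ← comp_whiskerRight_assoc, ← comp_whiskerRight_assoc, Category.assoc, Category.assoc,
    ← extLeft, hf, comp_whiskerRight_assoc, associator_inv_naturality_left_assoc]

namespace IsTrilinearLeft

variable {f : (A.A ⊗ B.A) ⊗ Z.A ⟶ X.A}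

/-- Restricting the third variable along `η` leaves linearity in the first two, which is what makes
`extLeft f` coequalize the pair defining `A ⊠ B`, tensored with `Z`. -/
lemma kap_extLeft (hf : IsTrilinearLeft f) :
    kap T A.A B.A ▷ Z.A ≫ extLeft f = (A.a ⊗ₘ B.a) ▷ Z.A ≫ f := by
  unfold IsTrilinearLeft at hf
  rw [extLeft, ← whisker_exchange_assoc, hf, tensorHom_def' (A.a ⊗ₘ B.a), Category.assoc,
    ← whiskerLeft_comp_assoc, eta_a, whiskerLeft_id, Category.id_comp]

lemma isLinearRight [IsMonoidal T] (hf : IsTrilinearLeft f) : IsLinearRight f := by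
  unfold IsTrilinearLeft at hf
  unfold IsLinearRight
  rw [extRight, ← eta_kap, comp_whiskerRight_assoc, hf, tensorHom_def (A.a ⊗ₘ B.a),
    Category.assoc, ← comp_whiskerRight_assoc, tensorHom_comp_tensorHom, eta_a, eta_a,
    id_tensorHom_id, id_whiskerRight, Category.id_comp]

end IsTrilinearLeft

namespace IsTrilinearRight

variable {f : A.A ⊗ (B.A ⊗ Z.A) ⟶ X.A}

lemma kap_extRight (hf : IsTrilinearRight f) :
    A.A ◁ kap T B.A Z.A ≫ extRight f = A.A ◁ (B.a ⊗ₘ Z.a) ≫ f := by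
  unfold IsTrilinearRight at hf
  rw [extRight, whisker_exchange_assoc, hf, tensorHom_def A.a, Category.assoc,
    ← comp_whiskerRight_assoc, eta_a, id_whiskerRight, Category.id_comp]

lemma isLinearLeft [IsMonoidal T] (hf : IsTrilinearRight f) : IsLinearLeft f := by
  unfold IsTrilinearRight at hf
  unfold IsLinearLeft
  rw [extLeft, ← eta_kap, whiskerLeft_comp_assoc, hf, tensorHom_def' A.a,
    Category.assoc, ← whiskerLeft_comp_assoc, tensorHom_comp_tensorHom, eta_a, eta_a,
    id_tensorHom_id, whiskerLeft_id, Category.id_comp]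

end IsTrilinearRight

/-- Bimorphisms `A ⊗ B ⟶ X` and `X ⊗ Z ⟶ Y` compose to a trimorphism. -/
lemma IsBilinear.whiskerRight_comp {f : A.A ⊗ B.A ⟶ X.A} (hf : IsBilinear f)
    {g : X.A ⊗ Z.A ⟶ Y.A} (hg : IsBilinear g) : IsTrilinearLeft (f ▷ Z.A ≫ g) := by
  unfold IsBilinear at hf hg
  unfold IsTrilinearLeft
  rw [Functor.map_comp_assoc, ← μ_natural_left_assoc, hg, tensorHom_def_assoc,
    ← comp_whiskerRight_assoc, ← comp_whiskerRight_assoc, Category.assoc, hf, comp_whiskerRight_assoc,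
    ← whisker_exchange_assoc, tensorHom_def_assoc]

/-- Bimorphisms `B ⊗ Z ⟶ X` and `A ⊗ X ⟶ Y` compose to a trimorphism. -/
lemma IsBilinear.whiskerLeft_comp {f : B.A ⊗ Z.A ⟶ X.A} (hf : IsBilinear f)
    {g : A.A ⊗ X.A ⟶ Y.A} (hg : IsBilinear g) : IsTrilinearRight (A.A ◁ f ≫ g) := by
  unfold IsBilinear at hf hg
  unfold IsTrilinearRight
  rw [Functor.map_comp_assoc, ← μ_natural_right_assoc, hg, tensorHom_def'_assoc,
    ← whiskerLeft_comp_assoc, ← whiskerLeft_comp_assoc, Category.assoc, hf,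
    whiskerLeft_comp_assoc, whisker_exchange_assoc, tensorHom_def'_assoc]

lemma IsTrilinearRight.associator_comp {f : A.A ⊗ (B.A ⊗ Z.A) ⟶ X.A} (hf : IsTrilinearRight f) :
    IsTrilinearLeft ((α_ A.A B.A Z.A).hom ≫ f) := by
  unfold IsTrilinearRight at hf
  unfold IsTrilinearLeft
  rw [Functor.map_comp_assoc, associativity_assoc, hf, associator_naturality_assoc]

lemma IsTrilinearLeft.associator_inv_comp {f : (A.A ⊗ B.A) ⊗ Z.A ⟶ X.A} (hf : IsTrilinearLeft f) :
    IsTrilinearRight ((α_ A.A B.A Z.A).inv ≫ f) := by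
  unfold IsTrilinearLeft at hf
  unfold IsTrilinearRight
  rw [Functor.map_comp_assoc, associativity_inv_assoc, hf, associator_inv_naturality_assoc]

end Multilinear

/-! ### Existence of the coequalizers -/

section Existence

variable {C : Type u} [Category.{v} C] [MonoidalCategory C] {T : CategoryTheory.Monad C}
  [T.toFunctor.LaxMonoidal] [IsMonoidal T]

/-- The common section is `T (η ⊗ η)`: it splits `μ · T κ` by the unit axiom for `κ`, and `T (a ⊗
b)` by the unit laws of the algebras. -/
instance isReflexivePair_pairFst_pairSnd (A B : T.Algebra) :
    IsReflexivePair (pairFst A B).f (pairSnd A B).f :=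
  .mk' (T.map (eta T A.A ⊗ₘ eta T B.A))
    (by
      change T.map _ ≫ T.map (kap T A.A B.A) ≫ mu T _ = 𝟙 (T.obj _)
      rw [← Functor.map_comp_assoc, eta_kap, map_eta_mu])
    (by
      change T.map _ ≫ T.map (A.a ⊗ₘ B.a) = 𝟙 (T.obj _)
      rw [← Functor.map_comp, tensorHom_comp_tensorHom, eta_a, eta_a, id_tensorHom_id,
        CategoryTheory.Functor.map_id])

variable (T) in
lemma nonempty_tensorProducts [HasReflexiveCoequalizers C]
    [Monad.PreservesColimitOfIsReflexivePair T.toFunctor] : Nonempty (TensorProducts T) :=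
  have (A B : T.Algebra) : HasCoequalizer (pairFst A B) (pairSnd A B) :=
    hasCoequalizer_of_isReflexivePair _ _
  ⟨{ obj A B := coequalizer (pairFst A B) (pairSnd A B)
     q _ _ := coequalizer.π _ _
     condition _ _ := coequalizer.condition _ _
     isColimit _ _ := coequalizerIsCoequalizer _ _ }⟩

end Existence

/-! ### Universal property of the tensor product and its stability under tensoring -/

namespace TensorProducts

section Desc

variable {C : Type u} [Category.{v} C] [MonoidalCategory C] {T : CategoryTheory.Monad C}
  [T.toFunctor.LaxMonoidal] (D : TensorProducts T) {A B X : T.Algebra}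

/-- The coequalizer `q`, as a morphism in the base category. -/
def qf (A B : T.Algebra) : T.obj (A.A ⊗ B.A) ⟶ (D.obj A B).A := (D.q A B).f

lemma eta_qf (A B : T.Algebra) : eta T (A.A ⊗ B.A) ≫ D.qf A B = D.bim A B := rfl

lemma map_qf_a (A B : T.Algebra) : T.map (D.qf A B) ≫ (D.obj A B).a = mu T _ ≫ D.qf A B :=
  (D.q A B).h

lemma map_bim_a (A B : T.Algebra) : T.map (D.bim A B) ≫ (D.obj A B).a = D.qf A B := by
  rw [← eta_qf, Functor.map_comp_assoc, map_qf_a, reassoc_of% map_eta_mu]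

lemma qf_condition (A B : T.Algebra) : T.map (kap T A.A B.A) ≫ mu T (A.A ⊗ B.A) ≫ D.qf A B =
    T.map (A.a ⊗ₘ B.a) ≫ D.qf A B :=
  (Category.assoc _ _ _).symm.trans (congrArg Monad.Algebra.Hom.f (D.condition A B))

/-- Bilinearity is the coequalizer condition for `q`, restricted along `η`. -/
lemma bim_isBilinear (A B : T.Algebra) : IsBilinear (D.bim A B) := by
  unfold IsBilinear
  rw [map_bim_a, ← eta_qf, reassoc_of% eta_naturality, ← qf_condition, ← reassoc_of% eta_naturality,
    reassoc_of% eta_mu]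

/-- The morphism of algebras `A ⊠ B ⟶ X` induced by a bimorphism. -/
def desc (f : A.A ⊗ B.A ⟶ X.A) (hf : IsBilinear f) : D.obj A B ⟶ X :=
  Cofork.IsColimit.desc (D.isColimit A B) (T.free.map f ≫ structureMap X) (by
    ext
    change (T.map (kap T A.A B.A) ≫ mu T _) ≫ T.map f ≫ X.a = T.map (A.a ⊗ₘ B.a) ≫ T.map f ≫ X.a
    rw [← Functor.map_comp_assoc, ← hf, Category.assoc, map_comp_map_a])

lemma bim_desc (f : A.A ⊗ B.A ⟶ X.A) (hf : IsBilinear f) : D.bim A B ≫ (D.desc f hf).f = f := by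
  have h : D.qf A B ≫ (D.desc f hf).f = T.map f ≫ X.a :=
    congrArg Monad.Algebra.Hom.f (Cofork.IsColimit.π_desc' (D.isColimit A B) _ _)
  rw [← eta_qf, Category.assoc, h, eta_map_a]

/-- `q` is epi and its source is free on `A ⊗ B`. Together with `desc`, this makes `bim` the
universal bimorphism. -/
lemma hom_ext {f g : D.obj A B ⟶ X} (h : D.bim A B ≫ f.f = D.bim A B ≫ g.f) : f = g := by
  refine Cofork.IsColimit.hom_ext (D.isColimit A B) (free_hom_ext ?_)
  exact (Category.assoc _ _ _).symm.trans (h.trans (Category.assoc _ _ _))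

lemma bim_map {A' B' : T.Algebra} (g : A ⟶ A') (h : B ⟶ B') :
    D.bim A B ≫ (D.map g h).f = (g.f ⊗ₘ h.f) ≫ D.bim A' B' := by
  have e : D.qf A B ≫ (D.map g h).f = T.map (g.f ⊗ₘ h.f) ≫ D.qf A' B' :=
    congrArg Monad.Algebra.Hom.f (D.q_map g h)
  rw [← eta_qf, Category.assoc, e, ← eta_qf, reassoc_of% eta_naturality]

lemma map_id (A B : T.Algebra) : D.map (𝟙 A) (𝟙 B) = 𝟙 (D.obj A B) := by
  apply D.hom_ext
  rw [bim_map]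
  simp

lemma map_comp {A A' A'' B B' B'' : T.Algebra} (g : A ⟶ A') (h : B ⟶ B') (g' : A' ⟶ A'')
    (h' : B' ⟶ B'') : D.map g h ≫ D.map g' h' = D.map (g ≫ g') (h ≫ h') := by
  apply D.hom_ext
  rw [Monad.Algebra.comp_f, reassoc_of% bim_map, bim_map, bim_map, tensorHom_comp_tensorHom_assoc]
  rfl

end Desc

section Lift

variable {C : Type u} [Category.{v} C] [MonoidalCategory C] {T : CategoryTheory.Monad C}
  [T.toFunctor.LaxMonoidal] [IsMonoidal T] [HasReflexiveCoequalizers C]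
  [Monad.PreservesColimitOfIsReflexivePair T.toFunctor]
  (D : TensorProducts T) {A B Z X : T.Algebra}

/-- The coequalizer `q` is a coequalizer in the base category. -/
noncomputable def isColimitQf (A B : T.Algebra) :
    IsColimit (Cofork.ofπ (f := (pairFst A B).f) (g := (pairSnd A B).f) (D.qf A B)
      (congrArg Monad.Algebra.Hom.f (D.condition A B))) :=
  isColimitForgetCofork (D.isColimit A B)

/-- `T q` is a coequalizer in the base category. -/
noncomputable def isColimitMapQf (A B : T.Algebra) :
    IsColimit (Cofork.ofπ (f := T.map (pairFst A B).f) (g := T.map (pairSnd A B).f)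
      (T.map (D.qf A B)) ((T.map_comp _ _).symm.trans
        ((congrArg (fun f => T.map (Monad.Algebra.Hom.f f)) (D.condition A B)).trans
          (T.map_comp _ _)))) :=
  isColimitCoforkMapOfIsColimit T.toFunctor _ (D.isColimitQf A B)

section Right

variable [∀ Y : C, Monad.PreservesColimitOfIsReflexivePair (tensorRight Y ⋙ T.toFunctor)]

lemma qf_whiskerRight_hom_ext {Y : C} {k k' : (D.obj A B).A ⊗ Y ⟶ X.A}
    (h : D.qf A B ▷ Y ≫ k = D.qf A B ▷ Y ≫ k') : k = k' :=
  map_coequalizer_hom_ext (tensorRight Y) (D.isColimitQf A B) h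

/-- Needed to test linearity in the first variable, which is an equation between morphisms out of `T
(A ⊠ B) ⊗ Y`. -/
lemma map_qf_whiskerRight_hom_ext {Y : C} {k k' : T.obj (D.obj A B).A ⊗ Y ⟶ X.A}
    (h : T.map (D.qf A B) ▷ Y ≫ k = T.map (D.qf A B) ▷ Y ≫ k') : k = k' :=
  have := isReflexivePair_map T.toFunctor (pairFst A B).f (pairSnd A B).f
  map_coequalizer_hom_ext (tensorRight Y) (D.isColimitMapQf A B) h

/-- Since `q` is the extension of `bim`, linearity recovers the restriction along `q ⊗ Y` from the
one along `bim ⊗ Y`. The object `Y` carries no algebra structure. -/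
lemma bim_whiskerRight_hom_ext {Y : C} {k k' : (D.obj A B).A ⊗ Y ⟶ X.A}
    (hk : IsLinearLeft k) (hk' : IsLinearLeft k')
    (h : D.bim A B ▷ Y ≫ k = D.bim A B ▷ Y ≫ k') : k = k' := by
  unfold IsLinearLeft at hk hk'
  apply D.qf_whiskerRight_hom_ext
  rw [← map_bim_a, comp_whiskerRight_assoc, comp_whiskerRight_assoc, ← hk, ← hk',
    map_whiskerRight_extLeft, map_whiskerRight_extLeft, h]

/-- A trimorphism `(A ⊗ B) ⊗ Z ⟶ X` factors through a bimorphism `(A ⊠ B) ⊗ Z ⟶ X`. -/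
lemma exists_isBilinear_left {t : (A.A ⊗ B.A) ⊗ Z.A ⟶ X.A} (ht : IsTrilinearLeft t) :
    ∃ h : (D.obj A B).A ⊗ Z.A ⟶ X.A, D.bim A B ▷ Z.A ≫ h = t ∧ IsBilinear h := by
  -- The choice of `extLeft t` is forced: a factorization `h` of `t` that is linear on the left must
  -- restrict along `q ⊗ Z` to the extension of `t`.
  obtain ⟨h, hh⟩ := map_coequalizer_desc (tensorRight Z.A) (D.isColimitQf A B)
    (extLeft t) (by
      change (T.map (kap T A.A B.A) ≫ mu T _) ▷ Z.A ≫ _ = T.map (A.a ⊗ₘ B.a) ▷ Z.A ≫ _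
      rw [comp_whiskerRight_assoc, mu_whiskerRight_extLeft, map_whiskerRight_extLeft,
        map_whiskerRight_extLeft, ht.kap_extLeft])
  replace hh : D.qf A B ▷ Z.A ≫ h = extLeft t := hh
  refine ⟨h, ?_, .of_isLinear ?_ ?_⟩
  · rw [← eta_qf, comp_whiskerRight_assoc, hh, eta_extLeft]
  · apply D.map_qf_whiskerRight_hom_ext
    rw [map_whiskerRight_extLeft, hh, ← comp_whiskerRight_assoc, map_qf_a,
      comp_whiskerRight_assoc, hh, mu_whiskerRight_extLeft]
  -- Linearity on the right passes from `t` to `h` because the two extensions commute.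
  · apply D.qf_whiskerRight_hom_ext
    rw [whiskerRight_extRight, hh, extRight_extLeft, ← extLeft_extRight, ht.isLinearRight,
      ← whisker_exchange_assoc, hh, whiskerLeft_extLeft]

end Right

section Left

variable [∀ Y : C, Monad.PreservesColimitOfIsReflexivePair (tensorLeft Y ⋙ T.toFunctor)]

lemma whiskerLeft_qf_hom_ext {Y : C} {k k' : Y ⊗ (D.obj A B).A ⟶ X.A}
    (h : Y ◁ D.qf A B ≫ k = Y ◁ D.qf A B ≫ k') : k = k' :=
  map_coequalizer_hom_ext (tensorLeft Y) (D.isColimitQf A B) h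

lemma whiskerLeft_map_qf_hom_ext {Y : C} {k k' : Y ⊗ T.obj (D.obj A B).A ⟶ X.A}
    (h : Y ◁ T.map (D.qf A B) ≫ k = Y ◁ T.map (D.qf A B) ≫ k') : k = k' :=
  have := isReflexivePair_map T.toFunctor (pairFst A B).f (pairSnd A B).f
  map_coequalizer_hom_ext (tensorLeft Y) (D.isColimitMapQf A B) h

lemma whiskerLeft_bim_hom_ext {Y : C} {k k' : Y ⊗ (D.obj A B).A ⟶ X.A}
    (hk : IsLinearRight k) (hk' : IsLinearRight k')
    (h : Y ◁ D.bim A B ≫ k = Y ◁ D.bim A B ≫ k') : k = k' := by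
  unfold IsLinearRight at hk hk'
  apply D.whiskerLeft_qf_hom_ext
  rw [← map_bim_a, whiskerLeft_comp_assoc, whiskerLeft_comp_assoc, ← hk, ← hk',
    whiskerLeft_map_extRight, whiskerLeft_map_extRight, h]

/-- A trimorphism `A ⊗ (B ⊗ Z) ⟶ X` factors through a bimorphism `A ⊗ (B ⊠ Z) ⟶ X`. -/
lemma exists_isBilinear_right {t : A.A ⊗ (B.A ⊗ Z.A) ⟶ X.A} (ht : IsTrilinearRight t) :
    ∃ h : A.A ⊗ (D.obj B Z).A ⟶ X.A, A.A ◁ D.bim B Z ≫ h = t ∧ IsBilinear h := by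
  obtain ⟨h, hh⟩ := map_coequalizer_desc (tensorLeft A.A) (D.isColimitQf B Z)
    (extRight t) (by
      change A.A ◁ (T.map (kap T B.A Z.A) ≫ mu T _) ≫ _ = A.A ◁ T.map (B.a ⊗ₘ Z.a) ≫ _
      rw [whiskerLeft_comp_assoc, whiskerLeft_mu_extRight, whiskerLeft_map_extRight,
        whiskerLeft_map_extRight, ht.kap_extRight])
  replace hh : A.A ◁ D.qf B Z ≫ h = extRight t := hh
  refine ⟨h, ?_, .of_isLinear ?_ ?_⟩
  · rw [← eta_qf, whiskerLeft_comp_assoc, hh, eta_extRight]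
  · apply D.whiskerLeft_qf_hom_ext
    rw [whiskerLeft_extLeft, hh, extLeft_extRight, ← extRight_extLeft, ht.isLinearLeft,
      whisker_exchange_assoc, hh, whiskerRight_extRight]
  · apply D.whiskerLeft_map_qf_hom_ext
    rw [whiskerLeft_map_extRight, hh, ← whiskerLeft_comp_assoc, map_qf_a,
      whiskerLeft_comp_assoc, hh, whiskerLeft_mu_extRight]

end Left

end Lift

end TensorProducts

/-! ### Construction of the associator and the unitors -/

namespace TensorProducts

section Constraints

open Functor.LaxMonoidal

variable {C : Type u} [Category.{v} C] [MonoidalCategory C] {T : CategoryTheory.Monad C}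
  [T.toFunctor.LaxMonoidal] (D : TensorProducts T) {A B Z X : T.Algebra}

lemma eta_qLeft (A B Z : T.Algebra) :
    eta T ((A.A ⊗ B.A) ⊗ Z.A) ≫ (D.qLeft A B Z).f = D.bim A B ▷ Z.A ≫ D.bim (D.obj A B) Z := by
  change eta T _ ≫ T.map (D.bim A B ▷ Z.A) ≫ D.qf (D.obj A B) Z = _
  rw [← reassoc_of% eta_naturality, eta_qf]

lemma eta_qRight (A B Z : T.Algebra) :
    eta T (A.A ⊗ (B.A ⊗ Z.A)) ≫ (D.qRight A B Z).f = A.A ◁ D.bim B Z ≫ D.bim A (D.obj B Z) := by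
  change eta T _ ≫ T.map (A.A ◁ D.bim B Z) ≫ D.qf A (D.obj B Z) = _
  rw [← reassoc_of% eta_naturality, eta_qf]

/-- Both composites start at a free algebra, so the defining square of the associator may be checked
on generators, where it involves only universal bimorphisms. -/
lemma qLeft_comp_eq_iff (f : D.obj (D.obj A B) Z ⟶ D.obj A (D.obj B Z)) :
    D.qLeft A B Z ≫ f = T.free.map (α_ A.A B.A Z.A).hom ≫ D.qRight A B Z ↔
      D.bim A B ▷ Z.A ≫ D.bim (D.obj A B) Z ≫ f.f =
        (α_ A.A B.A Z.A).hom ≫ A.A ◁ D.bim B Z ≫ D.bim A (D.obj B Z) := by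
  have h₁ : eta T _ ≫ (D.qLeft A B Z ≫ f).f = D.bim A B ▷ Z.A ≫ D.bim (D.obj A B) Z ≫ f.f :=
    ((Category.assoc _ _ _).symm.trans (D.eta_qLeft A B Z =≫ f.f)).trans (Category.assoc _ _ _)
  have h₂ : eta T _ ≫ (T.free.map (α_ A.A B.A Z.A).hom ≫ D.qRight A B Z).f =
      (α_ A.A B.A Z.A).hom ≫ A.A ◁ D.bim B Z ≫ D.bim A (D.obj B Z) := by
    rw [← eta_qRight]
    exact ((reassoc_of% (eta_naturality T (α_ A.A B.A Z.A).hom)) _).symm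
  rw [← h₁, ← h₂]
  exact ⟨fun h => by rw [h], free_hom_ext⟩

lemma q_comp_eq_iff {W : T.Algebra} (f : D.obj A B ⟶ W) (k : A.A ⊗ B.A ⟶ W.A) :
    D.q A B ≫ f = T.free.map k ≫ structureMap W ↔ D.bim A B ≫ f.f = k := by
  have h₁ : eta T _ ≫ (D.q A B ≫ f).f = D.bim A B ≫ f.f := (Category.assoc _ _ _).symm
  have h₂ : eta T _ ≫ (T.free.map k ≫ structureMap W).f = k := eta_map_a k
  conv_rhs => rw [← h₁, ← h₂]
  exact ⟨fun h => by rw [h], free_hom_ext⟩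

section LeftExt

variable [IsMonoidal T] [HasReflexiveCoequalizers C]
  [Monad.PreservesColimitOfIsReflexivePair T.toFunctor]
  [∀ Y : C, Monad.PreservesColimitOfIsReflexivePair (tensorRight Y ⋙ T.toFunctor)]

lemma hom_ext_left {f g : D.obj (D.obj A B) Z ⟶ X}
    (h : D.bim A B ▷ Z.A ≫ D.bim (D.obj A B) Z ≫ f.f =
      D.bim A B ▷ Z.A ≫ D.bim (D.obj A B) Z ≫ g.f) : f = g := by
  apply D.hom_ext
  exact D.bim_whiskerRight_hom_ext ((D.bim_isBilinear _ _).comp f).isLinearLeft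
    ((D.bim_isBilinear _ _).comp g).isLinearLeft h

/-- For the pentagon. After reassociation the first `bim` is tensored with the single object `Z ⊗ W`
of `C`, and the remaining composite is still linear in `A ⊠ B`, so it can be cancelled. -/
lemma hom_ext_left_left {W : T.Algebra} {f g : D.obj (D.obj (D.obj A B) Z) W ⟶ X}
    (h : (D.bim A B ▷ Z.A) ▷ W.A ≫ D.bim (D.obj A B) Z ▷ W.A ≫
        D.bim (D.obj (D.obj A B) Z) W ≫ f.f =
      (D.bim A B ▷ Z.A) ▷ W.A ≫ D.bim (D.obj A B) Z ▷ W.A ≫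
        D.bim (D.obj (D.obj A B) Z) W ≫ g.f) : f = g := by
  apply D.hom_ext_left
  have key (f : D.obj (D.obj (D.obj A B) Z) W ⟶ X) :
      IsLinearLeft ((α_ _ _ _).inv ≫ D.bim (D.obj A B) Z ▷ W.A ≫
        D.bim (D.obj (D.obj A B) Z) W ≫ f.f) :=
    (D.bim_isBilinear _ _).isLinearLeft.whiskerRight_comp
      ((D.bim_isBilinear _ _).comp f).isLinearLeft
  rw [← cancel_epi (α_ _ _ _).inv]
  refine D.bim_whiskerRight_hom_ext (key f) (key g) ?_
  rw [associator_inv_naturality_left_assoc, associator_inv_naturality_left_assoc, h]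

end LeftExt

section RightExt

variable [IsMonoidal T] [HasReflexiveCoequalizers C]
  [Monad.PreservesColimitOfIsReflexivePair T.toFunctor]
  [∀ Y : C, Monad.PreservesColimitOfIsReflexivePair (tensorLeft Y ⋙ T.toFunctor)]

lemma hom_ext_right {f g : D.obj A (D.obj B Z) ⟶ X}
    (h : A.A ◁ D.bim B Z ≫ D.bim A (D.obj B Z) ≫ f.f =
      A.A ◁ D.bim B Z ≫ D.bim A (D.obj B Z) ≫ g.f) : f = g := by
  apply D.hom_ext
  exact D.whiskerLeft_bim_hom_ext ((D.bim_isBilinear _ _).comp f).isLinearRight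
    ((D.bim_isBilinear _ _).comp g).isLinearRight h

end RightExt

section Associator

variable [IsMonoidal T] [HasReflexiveCoequalizers C]
  [Monad.PreservesColimitOfIsReflexivePair T.toFunctor]
  [∀ Y : C, Monad.PreservesColimitOfIsReflexivePair (tensorLeft Y ⋙ T.toFunctor)]
  [∀ Y : C, Monad.PreservesColimitOfIsReflexivePair (tensorRight Y ⋙ T.toFunctor)]

/-- Both sides represent trimorphisms, and associativity of `κ` identifies trimorphisms for the two
bracketings. -/
lemma exists_associator (A B Z : T.Algebra) :
    ∃ e : D.obj (D.obj A B) Z ≅ D.obj A (D.obj B Z),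
      D.bim A B ▷ Z.A ≫ D.bim (D.obj A B) Z ≫ e.hom.f =
        (α_ A.A B.A Z.A).hom ≫ A.A ◁ D.bim B Z ≫ D.bim A (D.obj B Z) := by
  obtain ⟨f, hf, hf'⟩ := D.exists_isBilinear_left
    ((D.bim_isBilinear B Z).whiskerLeft_comp (D.bim_isBilinear A _)).associator_comp
  obtain ⟨g, hg, hg'⟩ := D.exists_isBilinear_right
    ((D.bim_isBilinear A B).whiskerRight_comp (D.bim_isBilinear _ Z)).associator_inv_comp
  refine ⟨⟨D.desc f hf', D.desc g hg', D.hom_ext_left ?_, D.hom_ext_right ?_⟩, ?_⟩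
  · rw [Monad.Algebra.comp_f, reassoc_of% bim_desc, reassoc_of% hf, bim_desc, hg, Iso.hom_inv_id_assoc,
      Monad.Algebra.id_f, Category.comp_id]
  · rw [Monad.Algebra.comp_f, reassoc_of% bim_desc, reassoc_of% hg, bim_desc, hf, Iso.inv_hom_id_assoc,
      Monad.Algebra.id_f, Category.comp_id]
  · rw [bim_desc, hf]

end Associator

section Unitors

variable [IsMonoidal T]

lemma eta_whiskerRight_leftUnitBim (A : T.Algebra) :
    eta T (𝟙_ C) ▷ A.A ≫ leftUnitBim A = (λ_ A.A).hom := eta_extLeft (λ_ A.A).hom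

lemma whiskerLeft_eta_rightUnitBim (A : T.Algebra) :
    A.A ◁ eta T (𝟙_ C) ≫ rightUnitBim A = (ρ_ A.A).hom := eta_extRight (ρ_ A.A).hom

/-- This is left unitality of `κ`, whose unit `ε` is `η_E`. -/
lemma leftUnitor_isLinearRight (A : T.Algebra) : IsLinearRight (λ_ A.A).hom := by
  have h : Functor.LaxMonoidal.ε T.toFunctor = eta T (𝟙_ C) := IsMonoidal.ε_eq
  unfold IsLinearRight
  rw [extRight, ← h, ← left_unitality_assoc, leftUnitor_naturality]

lemma rightUnitor_isLinearLeft (A : T.Algebra) : IsLinearLeft (ρ_ A.A).hom := by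
  have h : Functor.LaxMonoidal.ε T.toFunctor = eta T (𝟙_ C) := IsMonoidal.ε_eq
  unfold IsLinearLeft
  rw [extLeft, ← h, ← right_unitality_assoc, rightUnitor_naturality]

/-- `leftUnitBim A` is `extLeft` of the unitor: linearity in `T E` is automatic, and linearity in
`A` survives because extensions commute. -/
lemma leftUnitBim_isBilinear (A : T.Algebra) :
    IsBilinear (A := T.free.obj (𝟙_ C)) (leftUnitBim A) := by
  have h := leftUnitor_isLinearRight A
  unfold IsLinearRight at h
  refine .of_isLinear (mu_whiskerRight_extLeft (λ_ A.A).hom).symm ?_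
  change extRight (extLeft (λ_ A.A).hom) = T.obj (𝟙_ C) ◁ A.a ≫ extLeft (λ_ A.A).hom
  rw [extRight_extLeft, ← extLeft_extRight, h, whiskerLeft_extLeft]

lemma rightUnitBim_isBilinear (A : T.Algebra) :
    IsBilinear (B := T.free.obj (𝟙_ C)) (rightUnitBim A) := by
  have h := rightUnitor_isLinearLeft A
  unfold IsLinearLeft at h
  refine .of_isLinear ?_ (whiskerLeft_mu_extRight (ρ_ A.A).hom).symm
  change extLeft (extRight (ρ_ A.A).hom) = A.a ▷ T.obj (𝟙_ C) ≫ extRight (ρ_ A.A).hom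
  rw [extLeft_extRight, ← extRight_extLeft, h, whiskerRight_extRight]

lemma exists_leftUnitor (A : T.Algebra) :
    ∃ e : D.obj (T.free.obj (𝟙_ C)) A ≅ A,
      D.bim (T.free.obj (𝟙_ C)) A ≫ e.hom.f = leftUnitBim A := by
  let b : T.obj (𝟙_ C) ⊗ A.A ⟶ (D.obj (T.free.obj (𝟙_ C)) A).A := D.bim (T.free.obj (𝟙_ C)) A
  have hb := D.bim_isBilinear (T.free.obj (𝟙_ C)) A
  have hr : extRight b = T.obj (𝟙_ C) ◁ A.a ≫ b := hb.isLinearRight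
  have hε : Functor.LaxMonoidal.ε T.toFunctor = eta T (𝟙_ C) := IsMonoidal.ε_eq
  -- The inverse inserts the generator of `T E`, informally `x ↦ η_E ⊗ x`; it is an algebra morphism
  -- by linearity in `A` and left unitality of `κ`.
  let m : A ⟶ D.obj (T.free.obj (𝟙_ C)) A :=
    { f := (λ_ A.A).inv ≫ eta T (𝟙_ C) ▷ A.A ≫ b
      h := by
        rw [leftUnitor_inv_naturality_assoc, whisker_exchange_assoc, ← hr, whiskerRight_extRight,
          extRight, ← hε, left_unitality_inv_assoc, Functor.map_comp_assoc] }
  have h₁ : b ≫ (D.desc _ (leftUnitBim_isBilinear A)).f = leftUnitBim A := D.bim_desc _ _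
  refine ⟨⟨D.desc _ (leftUnitBim_isBilinear A), m, D.hom_ext ?_, ?_⟩, h₁⟩
  · change b ≫ (D.desc _ (leftUnitBim_isBilinear A)).f ≫ m.f = b ≫ 𝟙 _
    rw [reassoc_of% h₁, Category.comp_id]
    -- Both sides are linear in the free algebra `T E`, so comparison on `E ⊗ A` is enough.
    refine IsLinearLeft.free_hom_ext ((leftUnitBim_isBilinear A).comp m).isLinearLeft
      hb.isLinearLeft ?_
    have h := eta_whiskerRight_leftUnitBim A =≫ m.f
    rw [Iso.hom_inv_id_assoc] at h
    exact (Category.assoc _ _ _).symm.trans h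
  · ext
    change ((λ_ A.A).inv ≫ eta T (𝟙_ C) ▷ A.A ≫ b) ≫ _ = 𝟙 A.A
    rw [Category.assoc, Category.assoc, h₁, Iso.inv_comp_eq, Category.comp_id]
    exact eta_whiskerRight_leftUnitBim A

lemma exists_rightUnitor (A : T.Algebra) :
    ∃ e : D.obj A (T.free.obj (𝟙_ C)) ≅ A,
      D.bim A (T.free.obj (𝟙_ C)) ≫ e.hom.f = rightUnitBim A := by
  let b : A.A ⊗ T.obj (𝟙_ C) ⟶ (D.obj A (T.free.obj (𝟙_ C))).A := D.bim A (T.free.obj (𝟙_ C))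
  have hb := D.bim_isBilinear A (T.free.obj (𝟙_ C))
  have hl : extLeft b = A.a ▷ T.obj (𝟙_ C) ≫ b := hb.isLinearLeft
  have hε : Functor.LaxMonoidal.ε T.toFunctor = eta T (𝟙_ C) := IsMonoidal.ε_eq
  let m : A ⟶ D.obj A (T.free.obj (𝟙_ C)) :=
    { f := (ρ_ A.A).inv ≫ A.A ◁ eta T (𝟙_ C) ≫ b
      h := by
        rw [rightUnitor_inv_naturality_assoc, ← whisker_exchange_assoc, ← hl, whiskerLeft_extLeft,
          extLeft, ← hε, right_unitality_inv_assoc, Functor.map_comp_assoc] }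
  have h₁ : b ≫ (D.desc _ (rightUnitBim_isBilinear A)).f = rightUnitBim A := D.bim_desc _ _
  refine ⟨⟨D.desc _ (rightUnitBim_isBilinear A), m, D.hom_ext ?_, ?_⟩, h₁⟩
  · change b ≫ (D.desc _ (rightUnitBim_isBilinear A)).f ≫ m.f = b ≫ 𝟙 _
    rw [reassoc_of% h₁, Category.comp_id]
    refine IsLinearRight.free_hom_ext ((rightUnitBim_isBilinear A).comp m).isLinearRight
      hb.isLinearRight ?_
    have h := whiskerLeft_eta_rightUnitBim A =≫ m.f
    rw [Iso.hom_inv_id_assoc] at h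
    exact (Category.assoc _ _ _).symm.trans h
  · ext
    change ((ρ_ A.A).inv ≫ A.A ◁ eta T (𝟙_ C) ≫ b) ≫ _ = 𝟙 A.A
    rw [Category.assoc, Category.assoc, h₁, Iso.inv_comp_eq, Category.comp_id]
    exact whiskerLeft_eta_rightUnitBim A

end Unitors

end Constraints

end TensorProducts

/-! ### Coherence of the induced constraints -/

section Triangle

open Functor.LaxMonoidal

variable {C : Type u} [Category.{v} C] [MonoidalCategory C] {T : CategoryTheory.Monad C}
  [T.toFunctor.LaxMonoidal]

/-- The image under `T` of the triangle identity of `C`, moved through `κ` by associativity and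
naturality; it is the core of the triangle for `⊠`. -/
lemma kap_triangle (X Y : C) :
    (α_ X (T.obj (𝟙_ C)) Y).hom ≫
        (eta T X ⊗ₘ (T.obj (𝟙_ C) ◁ eta T Y ≫ kap T (𝟙_ C) Y ≫ T.map (λ_ Y).hom)) ≫ kap T X Y =
      ((eta T X ▷ T.obj (𝟙_ C) ≫ kap T X (𝟙_ C) ≫ T.map (ρ_ X).hom) ⊗ₘ eta T Y) ≫ kap T X Y := by
  have hl : (α_ X (T.obj (𝟙_ C)) Y).hom ≫
        (eta T X ⊗ₘ (T.obj (𝟙_ C) ◁ eta T Y ≫ kap T (𝟙_ C) Y ≫ T.map (λ_ Y).hom)) =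
      ((eta T X ⊗ₘ 𝟙 (T.obj (𝟙_ C))) ⊗ₘ eta T Y) ≫ (α_ _ _ _).hom ≫
        T.obj X ◁ kap T (𝟙_ C) Y ≫ T.obj X ◁ T.map (λ_ Y).hom := by
    rw [associator_naturality_assoc, ← whiskerLeft_comp, ← id_tensorHom (T.obj X),
      tensorHom_comp_tensorHom, Category.comp_id, id_tensorHom]
  have hr : ((eta T X ▷ T.obj (𝟙_ C) ≫ kap T X (𝟙_ C) ≫ T.map (ρ_ X).hom) ⊗ₘ eta T Y) =
      ((eta T X ⊗ₘ 𝟙 (T.obj (𝟙_ C))) ⊗ₘ eta T Y) ≫ kap T X (𝟙_ C) ▷ T.obj Y ≫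
        T.map (ρ_ X).hom ▷ T.obj Y := by
    rw [← comp_whiskerRight, ← tensorHom_id _ (T.obj Y),
      tensorHom_comp_tensorHom, Category.comp_id, tensorHom_id]
  rw [reassoc_of% hl, hr, Category.assoc, Category.assoc, μ_natural_right, μ_natural_left,
    ← associativity_assoc, ← T.map_comp, MonoidalCategory.triangle]

end Triangle

namespace TensorProducts

section WhiskerMap

variable {C : Type u} [Category.{v} C] [MonoidalCategory C] {T : CategoryTheory.Monad C}
  [T.toFunctor.LaxMonoidal] (D : TensorProducts T) {A A' B B' : T.Algebra}

lemma bim_map_id (g : A ⟶ A') (B : T.Algebra) :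
    D.bim A B ≫ (D.map g (𝟙 B)).f = g.f ▷ B.A ≫ D.bim A' B := by
  rw [bim_map, Monad.Algebra.id_f, tensorHom_id]

lemma bim_id_map (A : T.Algebra) (h : B ⟶ B') :
    D.bim A B ≫ (D.map (𝟙 A) h).f = A.A ◁ h.f ≫ D.bim A B' := by
  rw [bim_map, Monad.Algebra.id_f, id_tensorHom]

end WhiskerMap

namespace InducedConstraints

section

variable {C : Type u} [Category.{v} C] [MonoidalCategory C] {T : CategoryTheory.Monad C}
  [T.toFunctor.LaxMonoidal] {D : TensorProducts T} (S : D.InducedConstraints)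

lemma bim_assoc (A B Z : T.Algebra) :
    D.bim A B ▷ Z.A ≫ D.bim (D.obj A B) Z ≫ (S.assoc A B Z).hom.f =
      (α_ A.A B.A Z.A).hom ≫ A.A ◁ D.bim B Z ≫ D.bim A (D.obj B Z) :=
  (D.qLeft_comp_eq_iff _).1 (S.assoc_spec A B Z)

lemma bim_assoc_inv (A B Z : T.Algebra) :
    A.A ◁ D.bim B Z ≫ D.bim A (D.obj B Z) ≫ (S.assoc A B Z).inv.f =
      (α_ A.A B.A Z.A).inv ≫ D.bim A B ▷ Z.A ≫ D.bim (D.obj A B) Z := by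
  have h := S.bim_assoc A B Z =≫ (S.assoc A B Z).inv.f
  simp only [Category.assoc, ← Monad.Algebra.comp_f, Iso.hom_inv_id, Monad.Algebra.id_f,
    Category.comp_id] at h
  rw [h, Iso.inv_hom_id_assoc]

lemma bim_left (A : T.Algebra) :
    D.bim (T.free.obj (𝟙_ C)) A ≫ (S.left A).hom.f = leftUnitBim A :=
  (D.q_comp_eq_iff _ _).1 (S.left_spec A)

lemma bim_right (A : T.Algebra) :
    D.bim A (T.free.obj (𝟙_ C)) ≫ (S.right A).hom.f = rightUnitBim A :=
  (D.q_comp_eq_iff _ _).1 (S.right_spec A)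

lemma left_naturality {A B : T.Algebra} (f : A ⟶ B) :
    D.map (𝟙 (T.free.obj (𝟙_ C))) f ≫ (S.left B).hom = (S.left A).hom ≫ f := by
  apply D.hom_ext
  rw [Monad.Algebra.comp_f, Monad.Algebra.comp_f, reassoc_of% bim_id_map, bim_left, reassoc_of% bim_left]
  change T.obj (𝟙_ C) ◁ f.f ≫ extLeft (λ_ B.A).hom = extLeft (λ_ A.A).hom ≫ f.f
  rw [whiskerLeft_extLeft, extLeft_comp, leftUnitor_naturality]

lemma right_naturality {A B : T.Algebra} (f : A ⟶ B) :
    D.map f (𝟙 (T.free.obj (𝟙_ C))) ≫ (S.right B).hom = (S.right A).hom ≫ f := by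
  apply D.hom_ext
  rw [Monad.Algebra.comp_f, Monad.Algebra.comp_f, reassoc_of% bim_map_id, bim_right, reassoc_of% bim_right]
  change f.f ▷ T.obj (𝟙_ C) ≫ extRight (ρ_ B.A).hom = extRight (ρ_ A.A).hom ≫ f.f
  rw [whiskerRight_extRight, extRight_comp, rightUnitor_naturality]

end

section

open Functor.LaxMonoidal

variable {C : Type u} [Category.{v} C] [MonoidalCategory C] {T : CategoryTheory.Monad C}
  [T.toFunctor.LaxMonoidal] {D : TensorProducts T} (S : D.InducedConstraints)
  [IsMonoidal T] [HasReflexiveCoequalizers C]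
  [Monad.PreservesColimitOfIsReflexivePair T.toFunctor]
  [∀ Y : C, Monad.PreservesColimitOfIsReflexivePair (tensorRight Y ⋙ T.toFunctor)]

lemma eq_of_inducedConstraints (S' : D.InducedConstraints) : S' = S := by
  have h₁ : S'.assoc = S.assoc := by
    ext A B Z : 4
    apply D.hom_ext_left
    rw [bim_assoc, bim_assoc]
  have h₂ : S'.left = S.left := by
    ext A : 2
    apply D.hom_ext
    rw [bim_left, bim_left]
  have h₃ : S'.right = S.right := by
    ext A : 2
    apply D.hom_ext
    rw [bim_right, bim_right]
  cases S
  cases S'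
  congr

lemma assoc_naturality {A A' B B' Z Z' : T.Algebra} (f : A ⟶ A') (g : B ⟶ B') (h : Z ⟶ Z') :
    D.map (D.map f g) h ≫ (S.assoc A' B' Z').hom =
      (S.assoc A B Z).hom ≫ D.map f (D.map g h) := by
  apply D.hom_ext_left
  rw [Monad.Algebra.comp_f, Monad.Algebra.comp_f, reassoc_of% bim_assoc, reassoc_of% bim_map, bim_map,
    MonoidalCategory.tensorHom_def, Category.assoc, ← comp_whiskerRight_assoc, bim_map,
    comp_whiskerRight_assoc, ← whisker_exchange_assoc, bim_assoc, ← tensorHom_def_assoc,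
    associator_naturality_assoc, ← id_tensorHom, ← id_tensorHom, tensorHom_comp_tensorHom_assoc,
    tensorHom_comp_tensorHom_assoc, bim_map, Category.comp_id, Category.id_comp]

/-- On the universal fourfold multilinear morphism each induced associator becomes one of `C`, and
the pentagon of `C` remains. -/
lemma pentagon (W X Y Z : T.Algebra) :
    D.map (S.assoc W X Y).hom (𝟙 Z) ≫ (S.assoc W (D.obj X Y) Z).hom ≫
        D.map (𝟙 W) (S.assoc X Y Z).hom =
      (S.assoc (D.obj W X) Y Z).hom ≫ (S.assoc W X (D.obj Y Z)).hom := by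
  apply D.hom_ext_left_left
  simp only [Monad.Algebra.comp_f]
  rw [reassoc_of% bim_map_id, ← comp_whiskerRight_assoc, ← comp_whiskerRight_assoc, Category.assoc,
    bim_assoc, comp_whiskerRight_assoc, comp_whiskerRight_assoc, reassoc_of% bim_assoc, bim_id_map,
    associator_naturality_middle_assoc, ← whiskerLeft_comp_assoc, ← whiskerLeft_comp_assoc,
    Category.assoc, bim_assoc, reassoc_of% bim_assoc, associator_naturality_left_assoc,
    ← whisker_exchange_assoc, bim_assoc, associator_naturality_right_assoc,
    ← whiskerLeft_comp_assoc, ← pentagon_assoc, ← whiskerLeft_comp_assoc]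

lemma triangle (A B : T.Algebra) :
    (S.assoc A (T.free.obj (𝟙_ C)) B).hom ≫ D.map (𝟙 A) (S.left B).hom =
      D.map (S.right A).hom (𝟙 B) := by
  have h := D.bim_isBilinear A B
  unfold IsBilinear at h
  apply D.hom_ext_left
  rw [Monad.Algebra.comp_f, reassoc_of% bim_assoc, bim_id_map, bim_map_id, ← whiskerLeft_comp_assoc,
    bim_left, ← comp_whiskerRight_assoc, bim_right]
  change (α_ A.A (T.obj (𝟙_ C)) B.A).hom ≫ A.A ◁ leftUnitBim B ≫ D.bim A B =
    rightUnitBim A ▷ B.A ≫ D.bim A B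
  -- Inserting `a · η = 1` exposes `(a ⊗ b) ≫ bim`, which bilinearity turns into an expression in
  -- `κ`, so that `kap_triangle` applies.
  have hl : A.A ◁ leftUnitBim B ≫ D.bim A B =
      (eta T A.A ⊗ₘ (T.obj (𝟙_ C) ◁ eta T B.A ≫ kap T _ _ ≫ T.map (λ_ B.A).hom)) ≫
        (A.a ⊗ₘ B.a) ≫ D.bim A B := by
    rw [tensorHom_comp_tensorHom_assoc, eta_a, id_tensorHom, Category.assoc, Category.assoc]
    rfl
  have hr : rightUnitBim A ▷ B.A ≫ D.bim A B =
      ((eta T A.A ▷ T.obj (𝟙_ C) ≫ kap T _ _ ≫ T.map (ρ_ A.A).hom) ⊗ₘ eta T B.A) ≫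
        (A.a ⊗ₘ B.a) ≫ D.bim A B := by
    rw [tensorHom_comp_tensorHom_assoc, eta_a, tensorHom_id, Category.assoc, Category.assoc]
    rfl
  refine (((α_ A.A (T.obj (𝟙_ C)) B.A).hom ≫= hl).trans ?_).trans hr.symm
  rw [← h]
  simpa only [Category.assoc] using kap_triangle A.A B.A =≫ (T.map (D.bim A B) ≫ _)

/-- The monoidal structure on the category of `T`-algebras given by induced constraints. -/
@[reducible]
def monoidalCategory : MonoidalCategory T.Algebra :=
  { toMonoidalCategoryStruct := S.toStruct
    tensorHom_def f g := by
      change D.map f g = D.map f (𝟙 _) ≫ D.map (𝟙 _) g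
      rw [D.map_comp, Category.comp_id, Category.id_comp]
    id_tensorHom_id := D.map_id
    tensorHom_comp_tensorHom := D.map_comp
    whiskerLeft_id := D.map_id
    id_whiskerRight := D.map_id
    associator_naturality := S.assoc_naturality
    leftUnitor_naturality := S.left_naturality
    rightUnitor_naturality := S.right_naturality
    pentagon := S.pentagon
    triangle := S.triangle }

end

end InducedConstraints

end TensorProducts

/-! ### The symmetric case -/

namespace TensorProducts

section Symmetry

variable {C : Type u} [Category.{v} C] [MonoidalCategory C] {T : CategoryTheory.Monad C}
  [T.toFunctor.LaxMonoidal] {D : TensorProducts T} [SymmetricCategory C]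

namespace InducedSymmetry

variable (σ : D.InducedSymmetry)

lemma bim_sym (A B : T.Algebra) :
    D.bim A B ≫ (σ.sym A B).hom.f = (β_ A.A B.A).hom ≫ D.bim B A := by
  have h : eta T _ ≫ (D.q A B ≫ (σ.sym A B).hom).f =
      eta T _ ≫ (T.free.map (β_ A.A B.A).hom ≫ D.q B A).f := by rw [σ.sym_spec]
  exact ((Category.assoc _ _ _).trans h).trans
    ((reassoc_of% (eta_naturality T (β_ A.A B.A).hom)) (D.qf B A)).symm

lemma eq_of_inducedSymmetry (σ' : D.InducedSymmetry) : σ' = σ := by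
  have h : σ'.sym = σ.sym := by
    ext A B : 3
    apply D.hom_ext
    rw [bim_sym, bim_sym]
  cases σ
  cases σ'
  congr

lemma sym_symmetry (A B : T.Algebra) : (σ.sym A B).hom ≫ (σ.sym B A).hom = 𝟙 _ := by
  apply D.hom_ext
  rw [Monad.Algebra.comp_f, reassoc_of% bim_sym, bim_sym, SymmetricCategory.symmetry_assoc]
  exact (Category.comp_id _).symm

lemma sym_naturality {A A' B B' : T.Algebra} (f : A ⟶ A') (g : B ⟶ B') :
    D.map f g ≫ (σ.sym A' B').hom = (σ.sym A B).hom ≫ D.map g f := by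
  apply D.hom_ext
  rw [Monad.Algebra.comp_f, Monad.Algebra.comp_f, reassoc_of% bim_sym, reassoc_of% bim_map, bim_sym, bim_map,
    BraidedCategory.braiding_naturality_assoc]

end InducedSymmetry

/-- Symmetry of `κ` enters here only: it lets the braiding of `C` induce a morphism `A ⊠ B ⟶ B ⊠ A`.
-/
lemma braiding_comp_isBilinear (hT : IsSymmetric T) {A B X : T.Algebra} {f : B.A ⊗ A.A ⟶ X.A}
    (hf : IsBilinear f) : IsBilinear ((β_ A.A B.A).hom ≫ f) := by
  unfold IsBilinear at hf ⊢
  rw [Functor.map_comp_assoc, ← reassoc_of% hT A.A B.A, hf,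
    BraidedCategory.braiding_naturality_assoc]

variable (D) in
lemma nonempty_inducedSymmetry (hT : IsSymmetric T) : Nonempty D.InducedSymmetry := by
  have hb (A B : T.Algebra) : IsBilinear ((β_ A.A B.A).hom ≫ D.bim B A) :=
    braiding_comp_isBilinear hT (D.bim_isBilinear B A)
  have hinv (A B : T.Algebra) : D.desc _ (hb A B) ≫ D.desc _ (hb B A) = 𝟙 _ := by
    apply D.hom_ext
    rw [Monad.Algebra.comp_f, reassoc_of% bim_desc, Category.assoc, bim_desc,
      SymmetricCategory.symmetry_assoc]
    exact (Category.comp_id _).symm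
  refine ⟨⟨fun A B => ⟨D.desc _ (hb A B), D.desc _ (hb B A), hinv A B, hinv B A⟩,
    fun A B => free_hom_ext ?_⟩⟩
  have h := D.bim_desc _ (hb A B)
  exact ((Category.assoc _ _ _).symm.trans h).trans
    ((reassoc_of% (eta_naturality T (β_ A.A B.A).hom)) (D.qf B A))

section

variable [IsMonoidal T] [HasReflexiveCoequalizers C]
  [Monad.PreservesColimitOfIsReflexivePair T.toFunctor]
  (S : D.InducedConstraints) (σ : D.InducedSymmetry)

lemma InducedConstraints.hexagon_forward
    [∀ Y : C, Monad.PreservesColimitOfIsReflexivePair (tensorRight Y ⋙ T.toFunctor)]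
    (X Y Z : T.Algebra) :
    (S.assoc X Y Z).hom ≫ (σ.sym X (D.obj Y Z)).hom ≫ (S.assoc Y Z X).hom =
      D.map (σ.sym X Y).hom (𝟙 Z) ≫ (S.assoc Y X Z).hom ≫ D.map (𝟙 Y) (σ.sym X Z).hom := by
  apply D.hom_ext_left
  simp only [Monad.Algebra.comp_f]
  rw [reassoc_of% S.bim_assoc, reassoc_of% σ.bim_sym, BraidedCategory.braiding_naturality_right_assoc,
    S.bim_assoc, reassoc_of% D.bim_map_id, ← comp_whiskerRight_assoc, σ.bim_sym,
    comp_whiskerRight_assoc, reassoc_of% S.bim_assoc, D.bim_id_map, ← whiskerLeft_comp_assoc,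
    σ.bim_sym, whiskerLeft_comp_assoc, BraidedCategory.hexagon_forward_assoc]

lemma InducedConstraints.hexagon_reverse
    [∀ Y : C, Monad.PreservesColimitOfIsReflexivePair (tensorLeft Y ⋙ T.toFunctor)]
    (X Y Z : T.Algebra) :
    (S.assoc X Y Z).inv ≫ (σ.sym (D.obj X Y) Z).hom ≫ (S.assoc Z X Y).inv =
      D.map (𝟙 X) (σ.sym Y Z).hom ≫ (S.assoc X Z Y).inv ≫ D.map (σ.sym X Z).hom (𝟙 Y) := by
  apply D.hom_ext_right
  simp only [Monad.Algebra.comp_f]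
  rw [reassoc_of% S.bim_assoc_inv, reassoc_of% σ.bim_sym, BraidedCategory.braiding_naturality_left_assoc,
    S.bim_assoc_inv, reassoc_of% D.bim_id_map, ← whiskerLeft_comp_assoc, σ.bim_sym,
    whiskerLeft_comp_assoc, reassoc_of% S.bim_assoc_inv, D.bim_map_id, ← comp_whiskerRight_assoc,
    σ.bim_sym, comp_whiskerRight_assoc, BraidedCategory.hexagon_reverse_assoc]

lemma InducedConstraints.isSymmetricMonoidalCategory
    [∀ Y : C, Monad.PreservesColimitOfIsReflexivePair (tensorLeft Y ⋙ T.toFunctor)]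
    [∀ Y : C, Monad.PreservesColimitOfIsReflexivePair (tensorRight Y ⋙ T.toFunctor)] :
    IsSymmetricMonoidalCategory S.toStruct σ.sym :=
  ⟨S.monoidalCategory,
   letI := S.monoidalCategory
   { braiding := σ.sym
     braiding_naturality_right := fun _ _ _ f => σ.sym_naturality (𝟙 _) f
     braiding_naturality_left := fun f _ => σ.sym_naturality f (𝟙 _)
     hexagon_forward := S.hexagon_forward σ
     hexagon_reverse := S.hexagon_reverse σ
     symmetry := σ.sym_symmetry }, rfl⟩

end

end Symmetry

section

variable {C : Type u} [Category.{v} C] [MonoidalCategory C] {T : CategoryTheory.Monad C}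
  [T.toFunctor.LaxMonoidal] (D : TensorProducts T) [IsMonoidal T] [HasReflexiveCoequalizers C]
  [Monad.PreservesColimitOfIsReflexivePair T.toFunctor]
  [∀ Y : C, Monad.PreservesColimitOfIsReflexivePair (tensorLeft Y ⋙ T.toFunctor)]
  [∀ Y : C, Monad.PreservesColimitOfIsReflexivePair (tensorRight Y ⋙ T.toFunctor)]

lemma nonempty_inducedConstraints : Nonempty D.InducedConstraints := by
  choose a ha using D.exists_associator
  choose l hl using D.exists_leftUnitor
  choose r hr using D.exists_rightUnitor
  exact ⟨⟨a, l, r, fun A B Z => (D.qLeft_comp_eq_iff _).2 (ha A B Z),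
    fun A => (D.q_comp_eq_iff _ _).2 (hl A), fun A => (D.q_comp_eq_iff _ _).2 (hr A)⟩⟩

end

end TensorProducts

end MonoidalMonad

/-! ### The main theorem -/

theorem mainTheorem2 {C : Type u} [Category.{v} C] [MonoidalCategory C]
    (T : CategoryTheory.Monad C) [T.toFunctor.LaxMonoidal] [MonoidalMonad.IsMonoidal T]
    [HasReflexiveCoequalizers C]
    (hleft : ∀ X : C, Monad.PreservesColimitOfIsReflexivePair (tensorLeft X ⋙ T.toFunctor))
    (hright : ∀ Y : C, Monad.PreservesColimitOfIsReflexivePair (tensorRight Y ⋙ T.toFunctor)) :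
    -- tensor products of algebras exist
    Nonempty (MonoidalMonad.TensorProducts T) ∧
    -- and, whichever coequalizers are chosen,
    ∀ D : MonoidalMonad.TensorProducts T,
      -- the induced structure morphisms exist and are unique, and make `(⊠, T E)` monoidal
      ∃ S : D.InducedConstraints,
        (∀ S' : D.InducedConstraints, S' = S) ∧
        MonoidalMonad.IsMonoidalCategory S.toStruct ∧
        -- symmetric case
        ∀ [SymmetricCategory C], MonoidalMonad.IsSymmetric T →
          ∃ σ : D.InducedSymmetry,
            (∀ σ' : D.InducedSymmetry, σ' = σ) ∧
            MonoidalMonad.IsSymmetricMonoidalCategory S.toStruct σ.sym := by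
  have := MonoidalMonad.preservesColimitOfIsReflexivePair_of_tensorLeft T
  refine ⟨MonoidalMonad.nonempty_tensorProducts T, fun D => ?_⟩
  obtain ⟨S⟩ := D.nonempty_inducedConstraints
  refine ⟨S, S.eq_of_inducedConstraints, ⟨S.monoidalCategory, rfl⟩, fun hT => ?_⟩
  obtain ⟨σ⟩ := D.nonempty_inducedSymmetry hT
  exact ⟨σ, σ.eq_of_inducedSymmetry, S.isSymmetricMonoidalCategory σ⟩
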